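/- Let $1\le m\le n$ and let $X$ be a compact complex manifold of dimension $n$ with a Kähler form $\omega$. Let $K$ be a compact Lie group acting smoothly and transitively on $X$ by biholomorphic maps, and suppose that $\omega$ is $K$-invariant: $g^*\omega=\omega$ for all $g\in K$. (This is the situation of a rational homogeneous manifold $X=G/H$, with $G$ a complex semisimple algebraic group, $H$ a parabolic subgroup and $K$ a maximal compact subgroup of $G$, which acts transitively on $X$, and with $\omega$ a $K$-invariant Kähler form.) Let $dg$ be a Haar measure on $K$. Conventions: $d^c=\frac{i}{2\pi}(\bar\partial-\partial)$, so $dd^c=\frac{i}{\pi}\partial\bar\partial$. A smooth real $(1,1)$-form $\alpha$ is $(\omega,m)$-positive if $\alpha^k\wedge\omega^{n-k}\ge 0$ on $X$ for $k=1,\dots,m$. A continuous function $\varphi:X\to\mathbb R$ is $(\omega,m)$-subharmonic if (i) in every holomorphic chart, for every smooth local potential $\rho$ of $\omega$ (i.e. $dd^c\rho=\omega$), $dd^c(\rho+\varphi)\wedge\omega^{n-1}\ge 0$ in the sense of currents, and (ii) for all smooth $(\omega,m)$-positive forms $\beta_1,\dots,\beta_{m-1}$ on $X$, $$(\omega+dd^c\varphi)\wedge\beta_1\wedge\dots\wedge\beta_{m-1}\wedge\omega^{n-m}\ge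 0$$ in the sense of distributions. For $E\subset X$ Borel put $$\mathrm{cap}_{\omega,m}(E)=\sup\Big\{\int_E(\omega+dd^cu)^m\wedge\omega^{n-m}\ :\ u\in C^2(X)\ (\omega,m)\text{-subharmonic},\ 0\le u\le 1\Big\},$$ and for $E\subset X$ put $\mathrm{Cap}_{\omega,m}(E)=\inf\{\mathrm{cap}_{\omega,m}(U): E\subset U,\ U \text{ open}\}$. A continuous function $\varphi$ belongs to $\mathcal P_m(X,\omega)$ if it is $(\omega,m)$-subharmonic and there is a sequence of $C^2$ $(\omega,m)$-subharmonic functions $\varphi_j$ such that for every $\delta>0$ there is an open set $U$ with $\mathrm{Cap}_{\omega,m}(U)\le\delta$ and $\varphi_j\to\varphi$ uniformly on $X\setminus U$. Let $\varphi$ be a continuous $(\omega,m)$-subharmonic function on $X$. Let $(\chi_\varepsilon)_{\varepsilon>0}$ be any family of nonnegative smooth functions on $K$ with $\int_K\chi_\varepsilon(g)\,dg=1$, whose supports shrink to the identity $e$ (every neighbourhood of $e$ contains $\operatorname{supp}\chi_\varepsilon$ for all sufficiently small $\varepsilon$), and put $$\varphi_\varepsilon(x)=\int_K\varphi(g^{-1}x)\,\chi_\varepsilon(g)\,dg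 .$$ Then for every $\varepsilon>0$ the function $\varphi_\varepsilon$ is smooth and $(\omega,m)$-subharmonic, and $\varphi_\varepsilon\to\varphi$ uniformly on $X$ as $\varepsilon\to0^+$. Moreover $\varphi\in\mathcal P_m(X,\omega)$; that is, every continuous $(\omega,m)$-subharmonic function belongs to $\mathcal P_m(X,\omega)$. -/

import Mathlib

open scoped Manifold ContDiff Topology ENNReal
open MeasureTheory Set Filter

noncomputable section

/-! ## Multilinear algebra of real two-forms on a complex vector space -/

/-- The real frame `e₁, i e₁, …, eₙ, i eₙ` attached to complex vectors `e₁, …, eₙ`. -/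
def realFrame {n : ℕ} {T : Type*} [AddCommGroup T] [Module ℂ T] (e : Fin n → T)
    (a : Fin n × Fin 2) : T :=
  if a.2 = 0 then e a.1 else Complex.I • e a.1

/-- The value of the top degree form `α₁ ∧ ⋯ ∧ αₙ` (a product of `n` real two-forms) on the
positively oriented real frame `(e₁, i e₁, …, eₙ, i eₙ)`:
`(α₁ ∧ ⋯ ∧ αₙ)(v₁, …, v₂ₙ) = 2⁻ⁿ ∑_σ sgn σ ∏ⱼ αⱼ(v_σ(2j-1), v_σ(2j))`. -/
def wedgeTop {n : ℕ} {T : Type*} [AddCommGroup T] [Module ℂ T] (α : Fin n → T → T → ℝ)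
    (e : Fin n → T) : ℝ :=
  (1 / 2 ^ n : ℝ) * ∑ σ : Equiv.Perm (Fin n × Fin 2), ((Equiv.Perm.sign σ : ℤ) : ℝ) *
    ∏ j : Fin n, α j (realFrame e (σ (j, 0))) (realFrame e (σ (j, 1)))

/-- The factors of `α ^ k ∧ ω ^ (n - k)`. -/
def powFactors {n : ℕ} {T : Type*} (k : ℕ) (α ω₀ : T → T → ℝ) : Fin n → T → T → ℝ :=
  fun j => if (j : ℕ) < k then α else ω₀

/-- The factors of `θ ∧ β₁ ∧ ⋯ ∧ βₘ₋₁ ∧ ω ^ (n - m)`. -/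
def mixedFactors {n : ℕ} {T : Type*} (m : ℕ) (θ : T → T → ℝ) (β : ℕ → T → T → ℝ)
    (ω₀ : T → T → ℝ) : Fin n → T → T → ℝ :=
  fun j => if (j : ℕ) = 0 then θ else if (j : ℕ) < m then β j else ω₀

/-! ## Calculus on `ℂⁿ` -/

/-- The standard basis of `ℂⁿ`. -/
def stdVec (n : ℕ) (j : Fin n) : Fin n → ℂ := Pi.single j 1

/-- The real coordinates `x₁, y₁, …, xₙ, yₙ` on `ℂⁿ`. -/
def realCoord {n : ℕ} (a : Fin n × Fin 2) (v : Fin n → ℂ) : ℝ :=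
  if a.2 = 0 then (v a.1).re else (v a.1).im

/-- The partial derivative of a function on `ℂⁿ` with respect to a real coordinate. -/
def realPartial {n : ℕ} (a : Fin n × Fin 2) (f : (Fin n → ℂ) → ℝ) (y : Fin n → ℂ) : ℝ :=
  fderiv ℝ f y (realFrame (stdVec n) a)

/-- The two-form `ddᶜ u = (i/π) ∂∂̄ u` of a `C²` function, with `dᶜ = (i/2π)(∂̄ - ∂)`, that is
`dᶜ u = -(1/2π) du ∘ J`. -/
def ddc {n : ℕ} (u : (Fin n → ℂ) → ℝ) (y v w : Fin n → ℂ) : ℝ :=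
  -(1 / (2 * Real.pi)) *
    (fderiv ℝ (fderiv ℝ u) y v (Complex.I • w) - fderiv ℝ (fderiv ℝ u) y w (Complex.I • v))

/-- The constant two-forms `τ_ab` with `ddᶜ u = ∑_{a,b} (∂²u/∂x_a∂x_b) τ_ab`. -/
def ddcSymbol {n : ℕ} (a b : Fin n × Fin 2) (v w : Fin n → ℂ) : ℝ :=
  -(1 / (2 * Real.pi)) * (realCoord a v * realCoord b (Complex.I • w) -
    realCoord a w * realCoord b (Complex.I • v))

/-- The value at the test function `χ` of the distribution
`ddᶜ u ∧ β₁ ∧ ⋯ ∧ βₘ₋₁ ∧ ω ^ (n - m) = ∑_{a,b} (∂²u/∂x_a∂x_b) c_ab`, where the second derivatives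
are taken in the sense of distributions and `c_ab` are the smooth functions
`τ_ab ∧ β₁ ∧ ⋯ ∧ βₘ₋₁ ∧ ω ^ (n - m)`; the forms `βⱼ` need not be closed. -/
def ddcPairing {n : ℕ} (m : ℕ) (u : (Fin n → ℂ) → ℝ)
    (β : ℕ → (Fin n → ℂ) → (Fin n → ℂ) → (Fin n → ℂ) → ℝ)
    (ω₀ : (Fin n → ℂ) → (Fin n → ℂ) → (Fin n → ℂ) → ℝ) (χ : (Fin n → ℂ) → ℝ) : ℝ :=
  ∫ y, u y * ∑ a : Fin n × Fin 2, ∑ b : Fin n × Fin 2,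
    realPartial a (realPartial b fun z =>
      χ z * wedgeTop (mixedFactors m (ddcSymbol a b) (fun j => β j z) (ω₀ z)) (stdVec n)) y

/-- Nonnegative smooth test functions with compact support in `Ω`. -/
structure IsTestFunction {n : ℕ} (Ω : Set (Fin n → ℂ)) (χ : (Fin n → ℂ) → ℝ) : Prop where
  smooth : ContDiff ℝ ∞ χ
  hasCompactSupport : HasCompactSupport χ
  tsupport_subset : tsupport χ ⊆ Ω
  nonneg : ∀ y, 0 ≤ χ y

/-! ## Forms on a complex manifold -/

section Manifold

variable {n : ℕ} {X : Type*} [TopologicalSpace X] [ChartedSpace (Fin n → ℂ) X]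

/-- The holomorphic charts of `X` (all charts of the maximal holomorphic atlas). -/
def holoCharts (n : ℕ) (X : Type*) [TopologicalSpace X] [ChartedSpace (Fin n → ℂ) X] :
    Set (OpenPartialHomeomorph X (Fin n → ℂ)) :=
  IsManifold.maximalAtlas 𝓘(ℂ, Fin n → ℂ) ω X

/-- The expression of a two-form in a chart: its pull-back under the inverse of the chart. -/
def chartForm
    (α : ∀ x : X, TangentSpace 𝓘(ℂ, Fin n → ℂ) x → TangentSpace 𝓘(ℂ, Fin n → ℂ) x → ℝ)
    (ψ : OpenPartialHomeomorph X (Fin n → ℂ)) (y v w : Fin n → ℂ) : ℝ :=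
  α (ψ.symm y) (mfderiv 𝓘(ℂ, Fin n → ℂ) 𝓘(ℂ, Fin n → ℂ) ψ.symm y v)
    (mfderiv 𝓘(ℂ, Fin n → ℂ) 𝓘(ℂ, Fin n → ℂ) ψ.symm y w)

/-- Smooth real `(1,1)`-forms: smooth real two-forms that are invariant under the complex
structure. -/
structure RealForm (n : ℕ) (X : Type*) [TopologicalSpace X] [ChartedSpace (Fin n → ℂ) X] where
  toFun : ∀ x : X, TangentSpace 𝓘(ℂ, Fin n → ℂ) x → TangentSpace 𝓘(ℂ, Fin n → ℂ) x → ℝ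
  add_left : ∀ x v₁ v₂ w, toFun x (v₁ + v₂) w = toFun x v₁ w + toFun x v₂ w
  smul_left : ∀ x (r : ℝ) v w, toFun x ((r : ℂ) • v) w = r * toFun x v w
  skew : ∀ x v w, toFun x v w = -toFun x w v
  invariant : ∀ x v w, toFun x (Complex.I • v) (Complex.I • w) = toFun x v w
  smooth : ∀ ψ ∈ holoCharts n X, ∀ v w : Fin n → ℂ,
    ContDiffOn ℝ ∞ (fun y => chartForm toFun ψ y v w) ψ.target

/-- Kähler forms: closed positive `(1,1)`-forms. -/
structure IsKahler (ω₀ : RealForm n X) : Prop where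
  pos : ∀ (x : X) (v : TangentSpace 𝓘(ℂ, Fin n → ℂ) x), v ≠ 0 →
    0 < ω₀.toFun x v (Complex.I • v)
  closed : ∀ ψ ∈ holoCharts n X, ∀ y ∈ ψ.target, ∀ v₁ v₂ v₃ : Fin n → ℂ,
    fderiv ℝ (fun z => chartForm ω₀.toFun ψ z v₂ v₃) y v₁ +
      fderiv ℝ (fun z => chartForm ω₀.toFun ψ z v₃ v₁) y v₂ +
      fderiv ℝ (fun z => chartForm ω₀.toFun ψ z v₁ v₂) y v₃ = 0

/-- `(ω,m)`-positive forms: `α ^ k ∧ ω ^ (n - k) ≥ 0` at every point, for `k = 1, …, m`. -/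
def IsMPositive (ω₀ : RealForm n X) (m : ℕ) (α : RealForm n X) : Prop :=
  ∀ (x : X) (k : ℕ), 1 ≤ k → k ≤ m →
    ∀ e : Fin n → TangentSpace 𝓘(ℂ, Fin n → ℂ) x,
      0 ≤ wedgeTop (powFactors k (α.toFun x) (ω₀.toFun x)) e

/-! ## Continuous `(ω,m)`-subharmonic functions -/

/-- Continuous `(ω,m)`-subharmonic functions. A continuous function is `ω`-subharmonic as soon as
it is weakly `ω`-subharmonic, i.e. `ddᶜ u ∧ ω ^ (n - 1) ≥ 0` in the sense of currents. -/
structure IsContSubharmonic (ω₀ : RealForm n X) (m : ℕ) (φ : X → ℝ) : Prop where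
  continuous : Continuous φ
  /-- In every local chart `ρ + φ` is `ω`-subharmonic for every local potential `ρ` of `ω`. -/
  potential : ∀ ψ ∈ holoCharts n X, ∀ Ω : Set (Fin n → ℂ), IsOpen Ω → Ω ⊆ ψ.target →
    ∀ ρ : (Fin n → ℂ) → ℝ, ContDiffOn ℝ ∞ ρ Ω →
      (∀ y ∈ Ω, ∀ v w, ddc ρ y v w = chartForm ω₀.toFun ψ y v w) →
      ∀ χ, IsTestFunction Ω χ →
        0 ≤ ddcPairing 1 (fun y => ρ y + φ (ψ.symm y)) (fun _ => chartForm ω₀.toFun ψ)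
          (chartForm ω₀.toFun ψ) χ
  /-- `(ω + ddᶜ φ) ∧ β₁ ∧ ⋯ ∧ βₘ₋₁ ∧ ω ^ (n - m) ≥ 0` in the sense of distributions, for all
  smooth `(ω,m)`-positive forms `β₁, …, βₘ₋₁`. -/
  positive : ∀ β : ℕ → RealForm n X, (∀ j, 1 ≤ j → j < m → IsMPositive ω₀ m (β j)) →
    ∀ ψ ∈ holoCharts n X, ∀ χ, IsTestFunction ψ.target χ →
      0 ≤ (∫ y, χ y * wedgeTop (mixedFactors m (chartForm ω₀.toFun ψ y)
            (fun j => chartForm (β j).toFun ψ y) (chartForm ω₀.toFun ψ y)) (stdVec n)) +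
          ddcPairing m (fun y => φ (ψ.symm y)) (fun j => chartForm (β j).toFun ψ)
            (chartForm ω₀.toFun ψ) χ

/-! ## Capacity and the class `P_m` -/

/-- The density in the chart `ψ`, with respect to Lebesgue measure on `ℂⁿ`, of the top degree form
`(ω + ddᶜ φ) ^ m ∧ ω ^ (n - m)`, for a `C²` function `φ`. -/
def hessianDensity (ω₀ : RealForm n X) (m : ℕ) (φ : X → ℝ)
    (ψ : OpenPartialHomeomorph X (Fin n → ℂ)) (y : Fin n → ℂ) : ℝ :=
  wedgeTop (powFactors m (fun v w => chartForm ω₀.toFun ψ y v w + ddc (φ ∘ ψ.symm) y v w)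
    (chartForm ω₀.toFun ψ y)) (stdVec n)

/-- The integral over a Borel set `E` of the nonnegative top degree form
`(ω + ddᶜ φ) ^ m ∧ ω ^ (n - m)`: the supremum over all finite families of disjoint Borel subsets
of `E`, each contained in a chart domain, of the sum of the integrals computed in the charts. -/
def hessianMass (ω₀ : RealForm n X) (m : ℕ) (φ : X → ℝ) (E : Set X) : ℝ≥0∞ :=
  ⨆ (N : ℕ) (ψ : Fin N → OpenPartialHomeomorph X (Fin n → ℂ)) (A : Fin N → Set X)
    (_ : ∀ i, ψ i ∈ holoCharts n X ∧ MeasurableSet[borel X] (A i) ∧ A i ⊆ E ∩ (ψ i).source)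
    (_ : Pairwise fun i j => Disjoint (A i) (A j)),
    ∑ i, ∫⁻ y in ψ i '' A i, ENNReal.ofReal (hessianDensity ω₀ m φ (ψ i) y)

/-- The set `SH_m(X,ω) ∩ C²(X)`. -/
def IsC2Subharmonic (ω₀ : RealForm n X) (m : ℕ) (φ : X → ℝ) : Prop :=
  ContMDiff 𝓘(ℝ, Fin n → ℂ) 𝓘(ℝ, ℝ) 2 φ ∧ IsContSubharmonic ω₀ m φ

/-- The inner capacity `cap_{ω,m}`. -/
def innerCap (ω₀ : RealForm n X) (m : ℕ) (E : Set X) : ℝ≥0∞ :=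
  ⨆ (φ : X → ℝ) (_ : IsC2Subharmonic ω₀ m φ) (_ : ∀ x, 0 ≤ φ x ∧ φ x ≤ 1), hessianMass ω₀ m φ E

/-- The outer capacity `Cap_{ω,m}`. -/
def outerCap (ω₀ : RealForm n X) (m : ℕ) (E : Set X) : ℝ≥0∞ :=
  ⨅ (U : Set X) (_ : IsOpen U) (_ : E ⊆ U), innerCap ω₀ m U

/-- Quasi-uniform convergence with respect to `Cap_{ω,m}`. -/
def QuasiUniformlyTendsto (ω₀ : RealForm n X) (m : ℕ) (φs : ℕ → X → ℝ) (φ : X → ℝ) : Prop :=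
  ∀ δ : ℝ, 0 < δ → ∃ U : Set X, IsOpen U ∧ outerCap ω₀ m U ≤ ENNReal.ofReal δ ∧
    TendstoUniformlyOn φs φ atTop Uᶜ

/-- The continuous members of the class `P_m(X,ω)`: continuous `(ω,m)`-subharmonic functions that
are quasi-uniform limits of sequences of `C²` `(ω,m)`-subharmonic functions. -/
def classP (ω₀ : RealForm n X) (m : ℕ) : Set (X → ℝ) :=
  {φ | IsContSubharmonic ω₀ m φ ∧
    ∃ φs : ℕ → X → ℝ, (∀ j, IsC2Subharmonic ω₀ m (φs j)) ∧ QuasiUniformlyTendsto ω₀ m φs φ}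

/-! ## Group actions and convolution -/

/-- The form `ω` is invariant under the action of `K`: `(g · )^* ω = ω` for all `g`. -/
def IsInvariantForm (K : Type*) [Group K] [MulAction K X] (ω₀ : RealForm n X) : Prop :=
  ∀ (g : K) (x : X) (v w : TangentSpace 𝓘(ℂ, Fin n → ℂ) x),
    ω₀.toFun (g • x)
      (mfderiv 𝓘(ℂ, Fin n → ℂ) 𝓘(ℂ, Fin n → ℂ) (fun z : X => g • z) x v)
      (mfderiv 𝓘(ℂ, Fin n → ℂ) 𝓘(ℂ, Fin n → ℂ) (fun z : X => g • z) x w) = ω₀.toFun x v w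

end Manifold

/-- Families of cut-off functions `χ_ε`, `ε > 0`, on a Lie group: nonnegative smooth functions of
integral one whose supports shrink to the identity as `ε` decreases to `0`. -/
structure IsCutoffFamily {d : ℕ} {K : Type*} [Group K] [TopologicalSpace K]
    [ChartedSpace (EuclideanSpace ℝ (Fin d)) K] [MeasurableSpace K] (μ : Measure K)
    (χ : ℝ → K → ℝ) : Prop where
  smooth : ∀ ε, 0 < ε → ContMDiff (𝓡 d) 𝓘(ℝ, ℝ) ∞ (χ ε)
  nonneg : ∀ ε, 0 < ε → ∀ g, 0 ≤ χ ε g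
  integral_eq_one : ∀ ε, 0 < ε → ∫ g, χ ε g ∂μ = 1
  support_shrinks : ∀ U ∈ 𝓝 (1 : K), ∀ᶠ ε in 𝓝[>] (0 : ℝ), tsupport (χ ε) ⊆ U

/-- The convolution `x ↦ ∫_K φ(g⁻¹ x) χ(g) dg`. -/
def groupConvolution {K X : Type*} [Group K] [MeasurableSpace K] [MulAction K X] (μ : Measure K)
    (χ : K → ℝ) (φ : X → ℝ) (x : X) : ℝ :=
  ∫ g, φ (g⁻¹ • x) * χ g ∂μ

end

/-! The function `φ_ε` is an average of the translates `φ(g⁻¹ ·)` with respect to a probability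
density on `K`. Each translate is again subharmonic, because `g` is biholomorphic and preserves `ω`:
it carries holomorphic charts to holomorphic charts and `(ω,m)`-positive forms to `(ω,m)`-positive
forms (`IsContSubharmonic.comp_diffeomorph`). For fixed test data, both defining conditions are
affine inequalities in `φ`, so Fubini's theorem passes them to averages
(`IsContSubharmonic.average`).

For smoothness, write `x = τ(x) • x₀` near `x₀` with `τ` smooth. Left invariance of Haar measure
gives `φ_ε(x) = ∫ φ(g⁻¹ x₀) χ_ε(τ(x) g) dg`, where `x` occurs only in the smooth factor, and one
differentiates under the integral sign. The section `τ` exists because the orbit map is a submersion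
(`surjective_fderiv_orbitMapInCharts`). By equivariance its rank is maximal at the identity, so a
neighbourhood of the identity has image of Hausdorff dimension at most that rank. The orbit map is
also open, so this image has full dimension.

Uniform convergence follows from compactness of `X`. It gives membership in `P_m` with empty
exceptional sets. -/

/-! ### Pull-back of charts, forms and subharmonic functions by biholomorphic maps -/

section Pullback

variable {n : ℕ} {X : Type*} [TopologicalSpace X] [ChartedSpace (Fin n → ℂ) X]

/-- The chart `ψ ∘ f⁻¹`, for a biholomorphic map `f`. -/
noncomputable def translateChart (f : X ≃ₘ^ω⟮𝓘(ℂ, Fin n → ℂ), 𝓘(ℂ, Fin n → ℂ)⟯ X)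
    (ψ : OpenPartialHomeomorph X (Fin n → ℂ)) : OpenPartialHomeomorph X (Fin n → ℂ) :=
  f.symm.toHomeomorph.transOpenPartialHomeomorph ψ

theorem translateChart_symm_apply (f : X ≃ₘ^ω⟮𝓘(ℂ, Fin n → ℂ), 𝓘(ℂ, Fin n → ℂ)⟯ X)
    (ψ : OpenPartialHomeomorph X (Fin n → ℂ)) (y : Fin n → ℂ) :
    (translateChart f ψ).symm y = f (ψ.symm y) := rfl

theorem translateChart_mem_holoCharts [IsManifold 𝓘(ℂ, Fin n → ℂ) ω X]
    (f : X ≃ₘ^ω⟮𝓘(ℂ, Fin n → ℂ), 𝓘(ℂ, Fin n → ℂ)⟯ X)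
    {ψ : OpenPartialHomeomorph X (Fin n → ℂ)} (hψ : ψ ∈ holoCharts n X) :
    translateChart f ψ ∈ holoCharts n X := by
  apply OpenPartialHomeomorph.mem_maximalAtlas_of_contMDiffOn
  · exact (contMDiffOn_of_mem_maximalAtlas hψ).comp f.symm.contMDiff.contMDiffOn
      fun x hx => hx
  · exact f.contMDiff.comp_contMDiffOn (contMDiffOn_symm_of_mem_maximalAtlas hψ)

theorem mfderiv_translateChart_symm [IsManifold 𝓘(ℂ, Fin n → ℂ) ω X]
    (f : X ≃ₘ^ω⟮𝓘(ℂ, Fin n → ℂ), 𝓘(ℂ, Fin n → ℂ)⟯ X)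
    {ψ : OpenPartialHomeomorph X (Fin n → ℂ)} (hψ : ψ ∈ holoCharts n X) {y : Fin n → ℂ}
    (hy : y ∈ ψ.target) (v : Fin n → ℂ) :
    mfderiv 𝓘(ℂ, Fin n → ℂ) 𝓘(ℂ, Fin n → ℂ) (translateChart f ψ).symm y v =
      mfderiv 𝓘(ℂ, Fin n → ℂ) 𝓘(ℂ, Fin n → ℂ) f (ψ.symm y)
        (mfderiv 𝓘(ℂ, Fin n → ℂ) 𝓘(ℂ, Fin n → ℂ) ψ.symm y v) := by
  have h1 : MDifferentiableAt 𝓘(ℂ, Fin n → ℂ) 𝓘(ℂ, Fin n → ℂ) f (ψ.symm y) :=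
    f.contMDiff.mdifferentiableAt (by simp)
  have h2 : MDifferentiableAt 𝓘(ℂ, Fin n → ℂ) 𝓘(ℂ, Fin n → ℂ) ψ.symm y :=
    (contMDiffAt_symm_of_mem_maximalAtlas hψ hy).mdifferentiableAt (by simp)
  have h3 := mfderiv_comp_apply y h1 h2 v
  exact h3

theorem chartForm_congr_symm
    (α : ∀ x : X, TangentSpace 𝓘(ℂ, Fin n → ℂ) x → TangentSpace 𝓘(ℂ, Fin n → ℂ) x → ℝ)
    {ψ ψ' : OpenPartialHomeomorph X (Fin n → ℂ)} (h : (ψ.symm : (Fin n → ℂ) → X) = ψ'.symm) :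
    chartForm α ψ = chartForm α ψ' := by
  unfold chartForm
  rw [h]

/-- The chart expression of the pull-back of a form. -/
theorem chartForm_pullback [IsManifold 𝓘(ℂ, Fin n → ℂ) ω X]
    (f : X ≃ₘ^ω⟮𝓘(ℂ, Fin n → ℂ), 𝓘(ℂ, Fin n → ℂ)⟯ X)
    (α : ∀ x : X, TangentSpace 𝓘(ℂ, Fin n → ℂ) x → TangentSpace 𝓘(ℂ, Fin n → ℂ) x → ℝ)
    {ψ : OpenPartialHomeomorph X (Fin n → ℂ)} (hψ : ψ ∈ holoCharts n X) {y : Fin n → ℂ}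
    (hy : y ∈ ψ.target) (v w : Fin n → ℂ) :
    chartForm (fun x v w => α (f x) (mfderiv 𝓘(ℂ, Fin n → ℂ) 𝓘(ℂ, Fin n → ℂ) f x v)
      (mfderiv 𝓘(ℂ, Fin n → ℂ) 𝓘(ℂ, Fin n → ℂ) f x w)) ψ y v w =
    chartForm α (translateChart f ψ) y v w := by
  unfold chartForm
  rw [mfderiv_translateChart_symm f hψ hy, mfderiv_translateChart_symm f hψ hy]
  rfl

/-- The pull-back of a `(1,1)`-form by a biholomorphic map. -/
noncomputable def RealForm.pullback [IsManifold 𝓘(ℂ, Fin n → ℂ) ω X]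
    (f : X ≃ₘ^ω⟮𝓘(ℂ, Fin n → ℂ), 𝓘(ℂ, Fin n → ℂ)⟯ X) (α : RealForm n X) : RealForm n X where
  toFun x v w := α.toFun (f x) (mfderiv 𝓘(ℂ, Fin n → ℂ) 𝓘(ℂ, Fin n → ℂ) f x v)
      (mfderiv 𝓘(ℂ, Fin n → ℂ) 𝓘(ℂ, Fin n → ℂ) f x w)
  add_left x v₁ v₂ w := by rw [map_add, α.add_left]
  smul_left x r v w := by rw [map_smul, α.smul_left]
  skew x v w := α.skew _ _ _
  invariant x v w := by rw [map_smul, map_smul, α.invariant]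
  -- In the chart `ψ` the pull-back has the coefficients of `α` in the translated chart, which is
  -- again holomorphic.
  smooth ψ hψ v w :=
    (α.smooth _ (translateChart_mem_holoCharts f hψ) v w).congr
      fun y hy => chartForm_pullback f α.toFun hψ hy v w

theorem realFrame_map {T T' : Type*} [AddCommGroup T] [Module ℂ T] [AddCommGroup T'] [Module ℂ T']
    (L : T →ₗ[ℂ] T') (e : Fin n → T) (a : Fin n × Fin 2) :
    L (realFrame e a) = realFrame (fun j => L (e j)) a := by
  unfold realFrame
  split_ifs <;> simp

theorem wedgeTop_map {T T' : Type*} [AddCommGroup T] [Module ℂ T] [AddCommGroup T'] [Module ℂ T']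
    (L : T →ₗ[ℂ] T') (α : Fin n → T' → T' → ℝ) (e : Fin n → T) :
    wedgeTop (fun j v w => α j (L v) (L w)) e = wedgeTop α (fun j => L (e j)) := by
  simp only [wedgeTop, realFrame_map]

/-- Since `f` preserves `ω`, the whole product `α ^ k ∧ ω ^ (n - k)` is pulled back, and its value
on `e` is the original value on the image of `e` under the differential. -/
theorem IsMPositive.pullback [IsManifold 𝓘(ℂ, Fin n → ℂ) ω X]
    (f : X ≃ₘ^ω⟮𝓘(ℂ, Fin n → ℂ), 𝓘(ℂ, Fin n → ℂ)⟯ X) {ω₀ α : RealForm n X} {m : ℕ}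
    (hf : (ω₀.pullback f).toFun = ω₀.toFun)
    (hα : IsMPositive ω₀ m α) : IsMPositive ω₀ m (α.pullback f) := by
  intro x k hk hkm e
  rw [← hf]
  have h := hα (f x) k hk hkm
    (fun j => mfderiv 𝓘(ℂ, Fin n → ℂ) 𝓘(ℂ, Fin n → ℂ) f x (e j))
  refine h.trans_eq ((wedgeTop_map
    (mfderiv 𝓘(ℂ, Fin n → ℂ) 𝓘(ℂ, Fin n → ℂ) f x).toLinearMap _ e).symm.trans ?_)
  congr 1
  ext j v w
  unfold powFactors
  split_ifs <;> rfl

/-- The forms enter only multiplied by `χ`. This matters because identities between chart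
expressions hold only on the chart target. -/
theorem ddcPairing_congr (m : ℕ) (u : (Fin n → ℂ) → ℝ)
    {β β' : ℕ → (Fin n → ℂ) → (Fin n → ℂ) → (Fin n → ℂ) → ℝ}
    {ω₀ ω₁ : (Fin n → ℂ) → (Fin n → ℂ) → (Fin n → ℂ) → ℝ} {χ : (Fin n → ℂ) → ℝ}
    (hβ : ∀ y, χ y ≠ 0 → ∀ j, β j y = β' j y) (hω : ∀ y, χ y ≠ 0 → ω₀ y = ω₁ y) :
    ddcPairing m u β ω₀ χ = ddcPairing m u β' ω₁ χ := by
  have h : ∀ a b : Fin n × Fin 2,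
      (fun z => χ z * wedgeTop (mixedFactors m (ddcSymbol a b) (fun j => β j z) (ω₀ z))
        (stdVec n)) =
      fun z => χ z * wedgeTop (mixedFactors m (ddcSymbol a b) (fun j => β' j z) (ω₁ z))
        (stdVec n) := by
    intro a b
    ext z
    by_cases hz : χ z = 0
    · simp [hz]
    · rw [hω z hz, funext fun j => hβ z hz j]
  simp only [ddcPairing, h]

theorem IsTestFunction.mem_of_ne_zero {Ω : Set (Fin n → ℂ)} {χ : (Fin n → ℂ) → ℝ}
    (h : IsTestFunction Ω χ) {y : Fin n → ℂ} (hy : χ y ≠ 0) : y ∈ Ω :=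
  h.tsupport_subset (subset_tsupport _ hy)

/-- The composition of a subharmonic function with a biholomorphic map that preserves `ω`. -/
theorem IsContSubharmonic.comp_diffeomorph [IsManifold 𝓘(ℂ, Fin n → ℂ) ω X]
    (f : X ≃ₘ^ω⟮𝓘(ℂ, Fin n → ℂ), 𝓘(ℂ, Fin n → ℂ)⟯ X) {ω₀ : RealForm n X} {m : ℕ} {φ : X → ℝ}
    (hf : (ω₀.pullback f).toFun = ω₀.toFun) (hf' : (ω₀.pullback f.symm).toFun = ω₀.toFun)
    (hφ : IsContSubharmonic ω₀ m φ) : IsContSubharmonic ω₀ m (fun x => φ (f x)) := by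
  have hω : ∀ ψ ∈ holoCharts n X, ∀ y ∈ ψ.target,
      chartForm ω₀.toFun (translateChart f ψ) y = chartForm ω₀.toFun ψ y := by
    intro ψ hψ y hy
    ext v w
    rw [← chartForm_pullback f ω₀.toFun hψ hy v w, ← congrArg (chartForm · ψ y v w) hf]
    rfl
  refine ⟨hφ.continuous.comp f.contMDiff.continuous, ?_, ?_⟩
  -- The function `φ ∘ f` read in `ψ` is `φ` read in `translateChart f ψ`, and `ω` has the same
  -- coefficients in both charts; hence `ρ`, `Ω` and `χ` are kept.
  · intro ψ hψ Ω hΩ hΩψ ρ hρ hρω χ hχ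
    have h := hφ.potential _ (translateChart_mem_holoCharts f hψ) Ω hΩ hΩψ ρ hρ
      (fun y hy v w => by rw [hρω y hy, hω ψ hψ y (hΩψ hy)]) χ hχ
    have hχω : ∀ y, χ y ≠ 0 →
        chartForm ω₀.toFun (translateChart f ψ) y = chartForm ω₀.toFun ψ y :=
      fun y hy => hω ψ hψ y (hΩψ (hχ.mem_of_ne_zero hy))
    rwa [ddcPairing_congr 1 _ (fun y hy _ => hχω y hy) hχω] at h
  · intro β hβ ψ hψ χ hχ
    have hψ' := translateChart_mem_holoCharts f hψ
    -- The forms `βⱼ` are not invariant. Testing `φ` in the translated chart with their pull-backs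
    -- by `f⁻¹` restores the coefficients of `βⱼ` in `ψ`.
    have hβψ : ∀ j, ∀ y ∈ ψ.target,
        chartForm ((β j).pullback f.symm).toFun (translateChart f ψ) y =
          chartForm (β j).toFun ψ y := by
      intro j y hy
      ext v w
      have h := chartForm_pullback f.symm (β j).toFun hψ' hy v w
      rw [chartForm_congr_symm (ψ' := ψ) (β j).toFun
        (by ext y; simp [translateChart_symm_apply])] at h
      exact h
    have h := hφ.positive (fun j => (β j).pullback f.symm)
      (fun j h1 h2 => (hβ j h1 h2).pullback f.symm hf') _ hψ' χ hχ
    have hχω : ∀ y, χ y ≠ 0 →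
        chartForm ω₀.toFun (translateChart f ψ) y = chartForm ω₀.toFun ψ y :=
      fun y hy => hω ψ hψ y (hχ.mem_of_ne_zero hy)
    have hχβ : ∀ y, χ y ≠ 0 → ∀ j,
        chartForm ((β j).pullback f.symm).toFun (translateChart f ψ) y =
          chartForm (β j).toFun ψ y :=
      fun y hy j => hβψ j y (hχ.mem_of_ne_zero hy)
    rw [ddcPairing_congr m _ hχβ hχω] at h
    convert h using 3
    swap
    · rfl
    ext y
    by_cases hy : χ y = 0
    · simp [hy]
    · rw [hχω y hy, funext fun j => hχβ y hy j]

end Pullback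

/-! ### Averages of subharmonic functions -/

section Average

variable {n : ℕ}

theorem ContDiff.realPartial {f : (Fin n → ℂ) → ℝ} (hf : ContDiff ℝ ∞ f) (a : Fin n × Fin 2) :
    ContDiff ℝ ∞ (realPartial a f) := by
  have h : ContDiff ℝ ∞ (fderiv ℝ f) := hf.fderiv_right (by simp)
  exact h.clm_apply contDiff_const

theorem tsupport_realPartial_subset (f : (Fin n → ℂ) → ℝ) (a : Fin n × Fin 2) :
    tsupport (realPartial a f) ⊆ tsupport f :=
  tsupport_fderiv_apply_subset ℝ _

theorem ContDiffOn.mul_of_tsupport_subset {E : Type*} [NormedAddCommGroup E] [NormedSpace ℝ E]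
    {Ω : Set E} (hΩ : IsOpen Ω) {χ f : E → ℝ} (hχ : ContDiff ℝ ∞ χ) (hχΩ : tsupport χ ⊆ Ω)
    (hf : ContDiffOn ℝ ∞ f Ω) : ContDiff ℝ ∞ (fun y => χ y * f y) := by
  rw [contDiff_iff_contDiffAt]
  intro y
  by_cases hy : y ∈ tsupport χ
  · exact hχ.contDiffAt.mul (hf.contDiffAt (hΩ.mem_nhds (hχΩ hy)))
  · have h : (fun y => χ y * f y) =ᶠ[𝓝 y] fun _ => 0 := by
      filter_upwards [notMem_tsupport_iff_eventuallyEq.1 hy] with z hz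
      simp [hz]
    exact contDiffAt_const.congr_of_eventuallyEq h

theorem ContDiffOn.wedgeTop {Ω : Set (Fin n → ℂ)}
    {α : (Fin n → ℂ) → Fin n → (Fin n → ℂ) → (Fin n → ℂ) → ℝ}
    (hα : ∀ j v w, ContDiffOn ℝ ∞ (fun y => α y j v w) Ω) (e : Fin n → Fin n → ℂ) :
    ContDiffOn ℝ ∞ (fun y => wedgeTop (α y) e) Ω := by
  unfold _root_.wedgeTop
  refine contDiffOn_const.mul (ContDiffOn.sum fun σ _ => contDiffOn_const.mul ?_)
  exact contDiffOn_prod fun j _ => hα _ _ _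

/-- The function against which `u` is integrated in `ddcPairing`. -/
noncomputable def ddcKernel (m : ℕ) (β : ℕ → (Fin n → ℂ) → (Fin n → ℂ) → (Fin n → ℂ) → ℝ)
    (ω₀ : (Fin n → ℂ) → (Fin n → ℂ) → (Fin n → ℂ) → ℝ) (χ : (Fin n → ℂ) → ℝ)
    (y : Fin n → ℂ) : ℝ :=
  ∑ a : Fin n × Fin 2, ∑ b : Fin n × Fin 2, realPartial a (realPartial b fun z =>
      χ z * wedgeTop (mixedFactors m (ddcSymbol a b) (fun j => β j z) (ω₀ z)) (stdVec n)) y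

theorem continuous_ddcKernel {Ω : Set (Fin n → ℂ)} (hΩ : IsOpen Ω) (m : ℕ)
    {β : ℕ → (Fin n → ℂ) → (Fin n → ℂ) → (Fin n → ℂ) → ℝ}
    {ω₀ : (Fin n → ℂ) → (Fin n → ℂ) → (Fin n → ℂ) → ℝ} {χ : (Fin n → ℂ) → ℝ}
    (hβ : ∀ j v w, ContDiffOn ℝ ∞ (fun y => β j y v w) Ω)
    (hω : ∀ v w, ContDiffOn ℝ ∞ (fun y => ω₀ y v w) Ω) (hχ : IsTestFunction Ω χ) :
    Continuous (ddcKernel m β ω₀ χ) := by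
  refine continuous_finsetSum _ fun a _ => continuous_finsetSum _ fun b _ => ?_
  refine ContDiff.continuous (𝕜 := ℝ) (n := ∞) (ContDiff.realPartial (ContDiff.realPartial ?_ b) a)
  refine ContDiffOn.mul_of_tsupport_subset hΩ hχ.smooth hχ.tsupport_subset
    (ContDiffOn.wedgeTop (fun j v w => ?_) _)
  unfold mixedFactors
  split_ifs
  · exact contDiffOn_const
  · exact hβ _ v w
  · exact hω v w

theorem tsupport_ddcKernel_subset (m : ℕ)
    (β : ℕ → (Fin n → ℂ) → (Fin n → ℂ) → (Fin n → ℂ) → ℝ)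
    (ω₀ : (Fin n → ℂ) → (Fin n → ℂ) → (Fin n → ℂ) → ℝ) (χ : (Fin n → ℂ) → ℝ) :
    tsupport (ddcKernel m β ω₀ χ) ⊆ tsupport χ := by
  refine closure_minimal (fun y hy => ?_) (isClosed_tsupport _)
  by_contra h
  refine hy (Finset.sum_eq_zero fun a _ => Finset.sum_eq_zero fun b _ => ?_)
  refine image_eq_zero_of_notMem_tsupport fun h' => h ?_
  exact tsupport_mul_subset_left
    (tsupport_realPartial_subset _ _ (tsupport_realPartial_subset _ _ h'))

variable {K : Type*} [TopologicalSpace K] {E : Type*} [TopologicalSpace E]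

/-- Off the chart target `U` takes uncontrolled values; the factor `F` vanishes near every such
point, so the product is continuous everywhere. -/
theorem continuous_mul_of_tsupport_subset {Ω : Set E} (hΩ : IsOpen Ω) {U : K → E → ℝ}
    (hU : ContinuousOn (Function.uncurry U) (univ ×ˢ Ω)) {F : E → ℝ} (hF : Continuous F)
    (hFΩ : tsupport F ⊆ Ω) : Continuous (Function.uncurry fun g y => U g y * F y) := by
  have hsub : tsupport (Function.uncurry fun g y => U g y * F y) ⊆
      (univ : Set K) ×ˢ tsupport F := by
    refine closure_minimal (fun p hp => ⟨mem_univ _, subset_tsupport _ fun h => hp ?_⟩)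
      (isClosed_univ.prod (isClosed_tsupport _))
    simp [Function.uncurry, h]
  refine ContinuousOn.continuous_of_tsupport_subset (s := univ ×ˢ Ω)
    (hU.mul (hF.comp continuous_snd).continuousOn) (isOpen_univ.prod hΩ)
    (hsub.trans (prod_mono_right hFΩ))

theorem continuous_integral_mul [MeasurableSpace E] [OpensMeasurableSpace E]
    (ν : Measure E) [IsFiniteMeasureOnCompacts ν]
    {Ω : Set E} (hΩ : IsOpen Ω) {U : K → E → ℝ}
    (hU : ContinuousOn (Function.uncurry U) (univ ×ˢ Ω)) {F : E → ℝ} (hF : Continuous F)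
    (hFc : HasCompactSupport F) (hFΩ : tsupport F ⊆ Ω) :
    Continuous fun g => ∫ y, U g y * F y ∂ν := by
  rw [← continuousOn_univ]
  refine continuousOn_integral_of_compact_support (k := tsupport F) hFc
    (continuous_mul_of_tsupport_subset hΩ hU hF hFΩ).continuousOn fun g y _ hy => ?_
  rw [image_eq_zero_of_notMem_tsupport hy, mul_zero]

variable [CompactSpace K] [T2Space K] [MeasurableSpace K] [BorelSpace K]
  [T2Space E] [MeasurableSpace E] [OpensMeasurableSpace E]

/-- The integral of an average against a function of compact support. -/
theorem integral_average_mul (μ : Measure K) [IsFiniteMeasureOnCompacts μ]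
    (ν : Measure E) [IsFiniteMeasureOnCompacts ν]
    {Ω : Set E} (hΩ : IsOpen Ω) {U : K → E → ℝ}
    (hU : ContinuousOn (Function.uncurry U) (univ ×ˢ Ω)) {F : E → ℝ} (hF : Continuous F)
    (hFc : HasCompactSupport F) (hFΩ : tsupport F ⊆ Ω) {κ : K → ℝ} (hκ : Continuous κ) :
    ∫ y, (∫ g, U g y * κ g ∂μ) * F y ∂ν = ∫ g, (∫ y, U g y * F y ∂ν) * κ g ∂μ := by
  have hc := continuous_mul_of_tsupport_subset hΩ hU hF hFΩ
  -- Fubini for a continuous integrand of compact support needs no σ-finiteness of the measures.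
  have h := integral_integral_swap_of_hasCompactSupport
    (f := fun g y => U g y * F y * κ g) (μ := μ) (ν := ν)
    (hc.mul (hκ.comp continuous_fst)) ?_
  · simp_rw [← integral_mul_const]
    rw [h]
    exact integral_congr_ae (.of_forall fun y => integral_congr_ae (.of_forall fun g => by ring))
  · refine HasCompactSupport.of_support_subset_isCompact
      (K := univ ×ˢ tsupport F) (isCompact_univ.prod hFc) fun p hp =>
      ⟨mem_univ _, subset_tsupport _ fun h => hp ?_⟩
    simp [Function.uncurry, h]

end Average

/-- Averages of continuous families of continuous subharmonic functions are subharmonic. -/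
theorem IsContSubharmonic.average {n m : ℕ} {X : Type*} [TopologicalSpace X]
    [ChartedSpace (Fin n → ℂ) X] {ω₀ : RealForm n X}
    {K : Type*} [TopologicalSpace K] [CompactSpace K] [T2Space K] [MeasurableSpace K]
    [BorelSpace K] (μ : Measure K) [IsFiniteMeasureOnCompacts μ] {U : K → X → ℝ}
    (hUc : Continuous (Function.uncurry U)) (hU : ∀ g, IsContSubharmonic ω₀ m (U g)) {κ : K → ℝ}
    (hκ : Continuous κ) (hκ0 : ∀ g, 0 ≤ κ g) (hκ1 : ∫ g, κ g ∂μ = 1) :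
    IsContSubharmonic ω₀ m (fun x => ∫ g, U g x * κ g ∂μ) := by
  have hint : ∀ {f : K → ℝ}, Continuous f → Integrable f μ := fun hf =>
    hf.integrable_of_hasCompactSupport (HasCompactSupport.of_compactSpace _)
  have hUψ : ∀ ψ : OpenPartialHomeomorph X (Fin n → ℂ),
      ContinuousOn (Function.uncurry fun g y => U g (ψ.symm y)) (univ ×ˢ ψ.target) := by
    intro ψ
    refine hUc.comp_continuousOn (continuousOn_fst.prodMk ?_)
    exact ψ.symm.continuousOn.comp continuousOn_snd fun p hp => hp.2
  refine ⟨?_, ?_, ?_⟩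
  · rw [← continuousOn_univ]
    refine continuousOn_integral_of_compact_support (k := univ) isCompact_univ
      (Continuous.continuousOn ?_) fun x g _ hg => absurd (mem_univ g) hg
    exact (hUc.comp continuous_swap).mul (hκ.comp continuous_snd)
  · intro ψ hψ Ω hΩ hΩψ ρ hρ hρω χ hχ
    have hω : ∀ v w, ContDiffOn ℝ ∞ (fun y => chartForm ω₀.toFun ψ y v w) Ω :=
      fun v w => (ω₀.smooth ψ hψ v w).mono hΩψ
    have hF := continuous_ddcKernel hΩ 1 (fun _ => hω) hω hχ
    have hFs := tsupport_ddcKernel_subset 1 (fun _ => chartForm ω₀.toFun ψ)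
      (chartForm ω₀.toFun ψ) χ
    -- The pairing is integration against `ddcKernel`, a continuous function supported in the
    -- support of `χ`, so it commutes with the average over `K`.
    have h := integral_average_mul μ volume hΩ (U := fun g y => ρ y + U g (ψ.symm y))
      ((hρ.continuousOn.comp continuousOn_snd fun p hp => hp.2).add
        ((hUψ ψ).mono (prod_mono_right hΩψ))) hF
      (hχ.hasCompactSupport.mono' (subset_tsupport _ |>.trans hFs))
      (hFs.trans hχ.tsupport_subset) hκ
    have hsplit : ∀ y, ρ y + ∫ g, U g (ψ.symm y) * κ g ∂μ =
        ∫ g, (ρ y + U g (ψ.symm y)) * κ g ∂μ := by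
      intro y
      simp_rw [add_mul]
      rw [integral_add ((hint hκ).const_mul _), integral_const_mul, hκ1, mul_one]
      exact hint (((hUc.comp (continuous_id.prodMk continuous_const))).mul hκ)
    simp only [ddcPairing, hsplit]
    refine (integral_nonneg fun g => mul_nonneg ?_ (hκ0 g)).trans_eq h.symm
    exact (hU g).potential ψ hψ Ω hΩ hΩψ ρ hρ hρω χ hχ
  · intro β hβ ψ hψ χ hχ
    have hω := ω₀.smooth ψ hψ
    have hF := continuous_ddcKernel ψ.open_target m (fun j => (β j).smooth ψ hψ) hω hχ
    have hFs := tsupport_ddcKernel_subset m (fun j => chartForm (β j).toFun ψ)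
      (chartForm ω₀.toFun ψ) χ
    have hFc := hχ.hasCompactSupport.mono' (subset_tsupport _ |>.trans hFs)
    have h := integral_average_mul μ volume ψ.open_target (hUψ ψ) hF hFc
      (hFs.trans hχ.tsupport_subset) hκ
    have hi : Integrable (fun g => ddcPairing m (fun y => U g (ψ.symm y))
        (fun j => chartForm (β j).toFun ψ) (chartForm ω₀.toFun ψ) χ * κ g) μ := hint ((continuous_integral_mul volume ψ.open_target (hUψ ψ) hF hFc
      (hFs.trans hχ.tsupport_subset)).mul hκ)
    let c := ∫ y, χ y * wedgeTop (mixedFactors m (chartForm ω₀.toFun ψ y)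
      (fun j => chartForm (β j).toFun ψ y) (chartForm ω₀.toFun ψ y)) (stdVec n)
    -- The `φ`-independent term `c` can be put under the average because `κ` has integral one.
    have hsum : c + ddcPairing m (fun y => ∫ g, U g (ψ.symm y) * κ g ∂μ)
        (fun j => chartForm (β j).toFun ψ) (chartForm ω₀.toFun ψ) χ =
        ∫ g, (c + ddcPairing m (fun y => U g (ψ.symm y)) (fun j => chartForm (β j).toFun ψ)
          (chartForm ω₀.toFun ψ) χ) * κ g ∂μ := by
      simp_rw [add_mul]
      rw [integral_add ((hint hκ).const_mul _) hi, integral_const_mul, hκ1, mul_one]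
      exact congrArg (c + ·) h
    refine hsum.symm.le.trans' ?_
    exact integral_nonneg fun g => mul_nonneg ((hU g).positive β hβ ψ hψ χ hχ) (hκ0 g)

/-! ### Maps of locally maximal rank and the dimension of their images -/

/-- If a linear map `D` on a product, of rank at most `dim W`, has the first projection as a
composition `P ∘ D`, then it vanishes on the second factor. -/
theorem LinearMap.apply_zero_prod_eq_zero {W N : Type*} [AddCommGroup W] [Module ℝ W]
    {F : Type*} [AddCommGroup N] [Module ℝ N] [AddCommGroup F] [Module ℝ F] [FiniteDimensional ℝ F]
    (D : W × N →ₗ[ℝ] F) (P : F →ₗ[ℝ] W) (hPD : P ∘ₗ D = LinearMap.fst ℝ W N)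
    (hr : Module.finrank ℝ (LinearMap.range D) ≤ Module.finrank ℝ W) (v : N) :
    D (0, v) = 0 := by
  have hPD' : ∀ z, P (D z) = z.1 := fun z => LinearMap.congr_fun hPD z
  have hPs : Function.Surjective P := fun w => ⟨D (w, 0), hPD' _⟩
  have : FiniteDimensional ℝ W := Module.Finite.of_surjective P hPs
  -- Already `P` maps the range of `D` onto `W`, so the rank bound makes it injective there; and `P`
  -- kills `D (0, v)`.
  let Q : LinearMap.range D →ₗ[ℝ] W := P ∘ₗ (LinearMap.range D).subtype
  have hQ : Function.Surjective Q := fun w => ⟨⟨D (w, 0), _, rfl⟩, hPD' _⟩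
  have hle : Module.finrank ℝ W ≤ Module.finrank ℝ (LinearMap.range D) :=
    LinearMap.finrank_le_finrank_of_surjective hQ
  have hinj : Function.Injective Q :=
    (LinearMap.injective_iff_surjective_of_finrank_eq_finrank (hr.antisymm hle)).2 hQ
  have h : (⟨D (0, v), _, rfl⟩ : LinearMap.range D) = 0 := hinj (by
    rw [map_zero]
    exact hPD' _)
  exact congrArg Subtype.val h

section ConstantRank

variable {E F : Type*} [NormedAddCommGroup E] [NormedSpace ℝ E] [NormedAddCommGroup F]
  [NormedSpace ℝ F]

theorem ContDiffAt.exists_local_inverse [CompleteSpace E] {f : E → F} {f' : E ≃L[ℝ] F} {a : E}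
    {k : ℕ∞ω} (hf : ContDiffAt ℝ k f a) (hf' : HasFDerivAt f (f' : E →L[ℝ] F) a) (hk : k ≠ 0) :
    ∃ η : F → E, η (f a) = a ∧ ContDiffAt ℝ k η (f a) ∧ (∀ᶠ y in 𝓝 (f a), f (η y) = y) ∧
      ∀ᶠ x in 𝓝 a, η (f x) = x :=
  ⟨hf.localInverse hf' hk, hf.localInverse_apply_image hf' hk, hf.to_localInverse hf' hk,
    (hf.hasStrictFDerivAt' hf' hk).eventually_right_inverse,
    (hf.hasStrictFDerivAt' hf' hk).eventually_left_inverse⟩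

variable [FiniteDimensional ℝ E] [FiniteDimensional ℝ F]

/-- A map whose differential has maximal rank at `a` sends a neighbourhood of `a` to a set of
dimension at most this rank. -/
theorem exists_nhds_dimH_image_le {f : E → F} {a : E} (hf : ContDiffAt ℝ 1 f a)
    (hr : ∀ᶠ x in 𝓝 a, Module.finrank ℝ (LinearMap.range (fderiv ℝ f x).toLinearMap) ≤
      Module.finrank ℝ (LinearMap.range (fderiv ℝ f a).toLinearMap)) :
    ∃ V ∈ 𝓝 a, dimH (f '' V) ≤
      Module.finrank ℝ (LinearMap.range (fderiv ℝ f a).toLinearMap) := by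
  set A := fderiv ℝ f a with hA
  set W := LinearMap.range A.toLinearMap
  set N := LinearMap.ker A.toLinearMap
  obtain ⟨P, hP⟩ := Submodule.ClosedComplemented.of_finiteDimensional W
  obtain ⟨Q, hQ⟩ := Submodule.ClosedComplemented.of_finiteDimensional N
  -- With `P` and `Q` projections onto the range and kernel of `A`, the differential `(P A, Q)` at
  -- `a` is invertible. Thus `Φ` is a local coordinate system in which `P ∘ f` is the first
  -- coordinate.
  let Φ : E → W × N := fun x => (P (f x), Q x)
  have hΦ : ContDiffAt ℝ 1 Φ a :=
    (P.contDiff.contDiffAt.comp a hf).prodMk Q.contDiff.contDiffAt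
  have hdf : HasFDerivAt f A a := (hf.differentiableAt (by simp)).hasFDerivAt
  have hinj : Function.Injective ((P.comp A).prod Q) := by
    rw [injective_iff_map_eq_zero]
    intro v hv
    have h1 : P (A v) = 0 := congrArg Prod.fst hv
    have h2 : Q v = 0 := congrArg Prod.snd hv
    have h3 : A v = 0 := by
      have := hP ⟨A v, v, rfl⟩
      rw [h1] at this
      exact (congrArg Subtype.val this).symm
    have := hQ ⟨v, h3⟩
    rw [h2] at this
    exact (congrArg Subtype.val this).symm
  have hdim : Module.finrank ℝ E = Module.finrank ℝ (W × N) := by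
    rw [Module.finrank_prod, LinearMap.finrank_range_add_finrank_ker]
  let L : E ≃L[ℝ] W × N := (LinearEquiv.ofInjectiveOfFinrankEq
    ((P.comp A).prod Q).toLinearMap hinj hdim).toContinuousLinearEquiv
  have hΦ' : HasFDerivAt Φ (L : E →L[ℝ] W × N) a :=
    (P.hasFDerivAt.comp a hdf).prodMk Q.hasFDerivAt
  obtain ⟨Ψ, hΨa, hΨ, hΦΨ, hΨΦ⟩ := hΦ.exists_local_inverse hΦ' one_ne_zero
  have hΨt : Tendsto Ψ (𝓝 (Φ a)) (𝓝 a) := by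
    simpa [hΨa] using hΨ.continuousAt.tendsto
  have hev := (((hΨ.eventually (by simp)).and hΦΨ).and
    (hΨt.eventually ((hf.eventually (by simp)).and hr)))
  obtain ⟨r, hr0, hB⟩ := Metric.eventually_nhds_iff_ball.1 hev
  set B := Metric.ball (Φ a) r with hBdef
  have hdh : ∀ p ∈ B, HasFDerivAt (f ∘ Ψ) ((fderiv ℝ f (Ψ p)).comp (fderiv ℝ Ψ p)) p := by
    intro p hp
    obtain ⟨⟨h1, -⟩, h2, -⟩ := hB p hp
    exact (h2.differentiableAt (by simp)).hasFDerivAt.comp p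
      (h1.differentiableAt (by simp)).hasFDerivAt
  have hzero : ∀ p ∈ B, ∀ v : N, ((fderiv ℝ f (Ψ p)).comp (fderiv ℝ Ψ p)) (0, v) = 0 := by
    intro p hp v
    refine LinearMap.apply_zero_prod_eq_zero
      ((fderiv ℝ f (Ψ p)).comp (fderiv ℝ Ψ p)).toLinearMap P.toLinearMap ?_ ?_ v
    · have h1 : HasFDerivAt (fun q => P ((f ∘ Ψ) q))
          (P.comp ((fderiv ℝ f (Ψ p)).comp (fderiv ℝ Ψ p))) p :=
        P.hasFDerivAt.comp p (hdh p hp)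
      have h2 : HasFDerivAt (fun q => P ((f ∘ Ψ) q)) (ContinuousLinearMap.fst ℝ W N) p := by
        refine hasFDerivAt_fst.congr_of_eventuallyEq ?_
        filter_upwards [Metric.isOpen_ball.mem_nhds hp] with q hq
        exact congrArg Prod.fst (hB q hq).1.2
      have h3 := h1.unique h2
      exact LinearMap.ext fun z => DFunLike.congr_fun h3 z
    · refine le_trans ?_ (hB p hp).2.2
      exact Submodule.finrank_mono (LinearMap.range_comp_le_range _ _)
  have hBprod : B = Metric.ball (Φ a).1 r ×ˢ Metric.ball (Φ a).2 r := by
    rw [hBdef, ← ball_prod_same]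
  -- The rank bound kills the derivative of `f ∘ Ψ` along `N`, and the slices of `B` are connected,
  -- so `f ∘ Ψ` depends on the `W`-coordinate alone.
  have hconst : ∀ w ∈ Metric.ball (Φ a).1 r, ∀ v ∈ Metric.ball (Φ a).2 r,
      (f ∘ Ψ) (w, v) = (f ∘ Ψ) (w, (Φ a).2) := by
    intro w hw v hv
    have hd : ∀ u ∈ Metric.ball (Φ a).2 r, HasFDerivAt (fun u => (f ∘ Ψ) (w, u))
        (0 : N →L[ℝ] F) u := by
      intro u hu
      have hwu : (w, u) ∈ B := hBprod ▸ ⟨hw, hu⟩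
      have h := (hdh _ hwu).comp u (hasFDerivAt_prodMk_right w u)
      exact h.congr_fderiv (ContinuousLinearMap.ext fun z => hzero _ hwu z)
    exact Metric.isOpen_ball.is_const_of_fderiv_eq_zero
      (convex_ball _ _).isPreconnected
      (fun u hu => (hd u hu).differentiableAt.differentiableWithinAt)
      (fun u hu => (hd u hu).fderiv) hv (Metric.mem_ball_self hr0)
  refine ⟨Φ ⁻¹' B ∩ {x | Ψ (Φ x) = x},
    inter_mem (hΦ.continuousAt.preimage_mem_nhds (Metric.ball_mem_nhds _ hr0)) hΨΦ, ?_⟩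
  have hsub : f '' (Φ ⁻¹' B ∩ {x | Ψ (Φ x) = x}) ⊆
      (fun w => (f ∘ Ψ) (w, (Φ a).2)) '' Metric.ball (Φ a).1 r := by
    rintro _ ⟨x, ⟨hx, hx'⟩, rfl⟩
    rw [mem_preimage, hBprod] at hx
    refine ⟨(Φ x).1, hx.1, ?_⟩
    simp only
    rw [← hconst _ hx.1 _ hx.2]
    exact congrArg f hx'
  -- A `C¹` image of a ball in `W` has dimension at most `dim W`, which is the rank at `a`.
  refine (dimH_mono hsub).trans ((ContDiffOn.dimH_image_le ?_ (convex_ball _ _)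
    Subset.rfl).trans ((dimH_mono (subset_univ _)).trans_eq (Real.dimH_univ_eq_finrank W)))
  intro w hw
  have hwB : (w, (Φ a).2) ∈ B := hBprod ▸ ⟨hw, Metric.mem_ball_self hr0⟩
  obtain ⟨⟨h1, -⟩, h2, -⟩ := hB _ hwB
  exact ((h2.comp _ h1).comp w (contDiffAt_id.prodMk contDiffAt_const)).contDiffWithinAt

end ConstantRank

/-! ### The orbit map and its local sections -/

/-- The real smooth manifold underlying a complex manifold. -/
theorem IsManifold.restrictScalars_real (E X : Type*) [NormedAddCommGroup E] [NormedSpace ℂ E]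
    [TopologicalSpace X] [ChartedSpace E X] [IsManifold 𝓘(ℂ, E) ω X] :
    IsManifold 𝓘(ℝ, E) ∞ X := by
  refine isManifold_of_contDiffOn _ _ _ fun e e' he he' => ?_
  have h := contMDiffOn_of_mem_contDiffGroupoid (HasGroupoid.compatible
    (G := contDiffGroupoid ω 𝓘(ℂ, E)) he he')
  simpa using (h.contDiffOn.restrict_scalars ℝ).of_le le_top

section Orbit

variable {E F : Type*} [NormedAddCommGroup E] [NormedSpace ℝ E]
  [NormedAddCommGroup F] [NormedSpace ℝ F]
  {K : Type*} [Group K] [TopologicalSpace K] [ChartedSpace E K] [LieGroup 𝓘(ℝ, E) ∞ K]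
  {X : Type*} [TopologicalSpace X] [ChartedSpace F X] [IsManifold 𝓘(ℝ, F) ∞ X]
  [MulAction K X] [ContMDiffSMul 𝓘(ℝ, E) 𝓘(ℝ, F) ∞ K X]

/-- The orbit map `g ↦ g • x₀` in the charts at `1` and at `x₀`. -/
noncomputable def orbitMapInCharts (E F : Type*) [TopologicalSpace E] [TopologicalSpace F]
    {K : Type*} [Group K] [TopologicalSpace K] [ChartedSpace E K]
    {X : Type*} [TopologicalSpace X] [ChartedSpace F X] [MulAction K X] (x₀ : X) (p : E) : F :=
  chartAt F x₀ ((chartAt E (1 : K)).symm p • x₀)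

theorem contDiffAt_orbitMapInCharts (x₀ : X) {p : E} (hp : p ∈ (chartAt E (1 : K)).target)
    (hpx : (chartAt E (1 : K)).symm p • x₀ ∈ (chartAt F x₀).source) :
    ContDiffAt ℝ ∞ (orbitMapInCharts E F (K := K) x₀) p := by
  have := ContMDiffMul.toIsManifold (I := 𝓘(ℝ, E)) (n := ∞) (G := K)
  rw [← contMDiffAt_iff_contDiffAt]
  have h1 : ContMDiffAt 𝓘(ℝ, E) 𝓘(ℝ, E) ∞ (chartAt E (1 : K)).symm p :=
    contMDiffAt_symm_of_mem_maximalAtlas (IsManifold.chart_mem_maximalAtlas 1) hp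
  have h2 : ContMDiffAt 𝓘(ℝ, E) 𝓘(ℝ, F) ∞ (fun q => (chartAt E (1 : K)).symm q • x₀) p :=
    h1.smul contMDiffAt_const
  have h3 : ContMDiffAt 𝓘(ℝ, F) 𝓘(ℝ, F) ∞ (chartAt F x₀) ((chartAt E (1 : K)).symm p • x₀) :=
    contMDiffAt_of_mem_maximalAtlas (IsManifold.chart_mem_maximalAtlas x₀) hpx
  exact ContMDiffAt.comp p h3 h2

variable [FiniteDimensional ℝ F]

/-- By equivariance, the rank of the orbit map is largest at the identity. -/
theorem finrank_range_fderiv_orbitMapInCharts_le (x₀ : X) {p : E}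
    (hp : p ∈ (chartAt E (1 : K)).target)
    (hpx : (chartAt E (1 : K)).symm p • x₀ ∈ (chartAt F x₀).source) :
    Module.finrank ℝ (LinearMap.range
      (fderiv ℝ (orbitMapInCharts E F (K := K) x₀) p).toLinearMap) ≤
    Module.finrank ℝ (LinearMap.range (fderiv ℝ (orbitMapInCharts E F (K := K) x₀)
      (chartAt E (1 : K) 1)).toLinearMap) := by
  have := ContMDiffMul.toIsManifold (I := 𝓘(ℝ, E)) (n := ∞) (G := K)
  have := ContMDiffSMul.continuousSMul (I := 𝓘(ℝ, E)) (I' := 𝓘(ℝ, F)) (G := K) (M := X) ∞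
  have := topologicalGroup_of_lieGroup 𝓘(ℝ, E) ∞ (G := K)
  set cK := chartAt E (1 : K) with hcK
  set cX := chartAt F x₀ with hcX
  set f := orbitMapInCharts E F (K := K) x₀ with hf
  set g := cK.symm p with hg
  have h1 : (1 : K) ∈ cK.source := mem_chart_source E 1
  have hx₀ : x₀ ∈ cX.source := mem_chart_source F x₀
  have hp0 : cK 1 ∈ cK.target := cK.map_source h1
  have hcK1 : cK.symm (cK 1) = 1 := cK.left_inv h1
  have hf0 : f (cK 1) = cX x₀ := by
    change cX (cK.symm (cK 1) • x₀) = _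
    rw [hcK1, one_smul]
  -- Here `b` is the action of `g` and `c` is left translation by `g⁻¹`, both in charts. Near `p`,
  -- equivariance reads `f = b ∘ f ∘ c`, and `c` sends `p` to the point of `1`, so the differential
  -- at `p` factors through the one at the identity.
  let b : F → F := fun y => cX (g • cX.symm y)
  let c : E → E := fun q => cK (g⁻¹ * cK.symm q)
  have hcp : c p = cK 1 := by
    change cK (g⁻¹ * g) = _
    rw [inv_mul_cancel]
  have hcd : DifferentiableAt ℝ c p := by
    have h2 : ContMDiffAt 𝓘(ℝ, E) 𝓘(ℝ, E) ∞ (fun q => g⁻¹ * cK.symm q) p :=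
      contMDiffAt_const.mul
        (contMDiffAt_symm_of_mem_maximalAtlas (IsManifold.chart_mem_maximalAtlas 1) hp)
    have h3 : ContMDiffAt 𝓘(ℝ, E) 𝓘(ℝ, E) ∞ cK (g⁻¹ * cK.symm p) :=
      contMDiffAt_of_mem_maximalAtlas (IsManifold.chart_mem_maximalAtlas 1)
        (by rwa [← hg, inv_mul_cancel])
    exact (contMDiffAt_iff_contDiffAt.1 (ContMDiffAt.comp p h3 h2)).differentiableAt (by simp)
  have hbd : DifferentiableAt ℝ b (f (c p)) := by
    rw [hcp, hf0]
    have h2 : ContMDiffAt 𝓘(ℝ, F) 𝓘(ℝ, F) ∞ (fun y => g • cX.symm y) (cX x₀) :=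
      (contMDiffAt_const (I' := 𝓘(ℝ, E))).smul (contMDiffAt_symm_of_mem_maximalAtlas
        (IsManifold.chart_mem_maximalAtlas x₀) (cX.map_source hx₀))
    have h3 : ContMDiffAt 𝓘(ℝ, F) 𝓘(ℝ, F) ∞ cX (g • cX.symm (cX x₀)) :=
      contMDiffAt_of_mem_maximalAtlas (IsManifold.chart_mem_maximalAtlas x₀)
        (by rwa [cX.left_inv hx₀])
    exact (contMDiffAt_iff_contDiffAt.1 (ContMDiffAt.comp (cX x₀) h3 h2)).differentiableAt (by simp)
  have hfd : DifferentiableAt ℝ f (c p) := by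
    rw [hcp]
    exact (contDiffAt_orbitMapInCharts x₀ hp0 (by rwa [← hcK, hcK1, one_smul])).differentiableAt
      (by simp)
  have hcont : ContinuousAt (fun q => g⁻¹ * cK.symm q) p :=
    continuousAt_const.mul (cK.continuousAt_symm hp)
  have heq : f =ᶠ[𝓝 p] b ∘ f ∘ c := by
    have e1 : ∀ᶠ q in 𝓝 p, g⁻¹ * cK.symm q ∈ cK.source :=
      hcont.eventually_mem (cK.open_source.mem_nhds (by rwa [← hg, inv_mul_cancel]))
    have e2 : ∀ᶠ q in 𝓝 p, (g⁻¹ * cK.symm q) • x₀ ∈ cX.source := by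
      refine (hcont.smul continuousAt_const).eventually_mem (cX.open_source.mem_nhds ?_)
      change (g⁻¹ * g) • x₀ ∈ _
      rwa [inv_mul_cancel, one_smul]
    filter_upwards [e1, e2] with q hq1 hq2
    change cX (cK.symm q • x₀) = cX (g • cX.symm (cX (cK.symm (cK (g⁻¹ * cK.symm q)) • x₀)))
    rw [cK.left_inv hq1, cX.left_inv hq2, smul_smul, mul_inv_cancel_left]
  have hderiv : fderiv ℝ f p =
      (fderiv ℝ b (f (c p))).comp ((fderiv ℝ f (c p)).comp (fderiv ℝ c p)) :=
    heq.fderiv_eq.trans (hbd.hasFDerivAt.comp p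
      (hfd.hasFDerivAt.comp p hcd.hasFDerivAt)).fderiv
  rw [hderiv, ← hcp]
  change Module.finrank ℝ (LinearMap.range ((fderiv ℝ b (f (c p))).toLinearMap ∘ₗ
    ((fderiv ℝ f (c p)).toLinearMap ∘ₗ (fderiv ℝ c p).toLinearMap))) ≤ _
  rw [LinearMap.range_comp]
  exact (Submodule.finrank_map_le _ _).trans
    (Submodule.finrank_mono (LinearMap.range_comp_le_range _ _))

variable [FiniteDimensional ℝ E] [CompactSpace K] [T2Space X] [CompactSpace X] [MulAction.IsPretransitive K X]

/-- The orbit map of a transitive smooth action of a compact Lie group is a submersion. -/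
theorem surjective_fderiv_orbitMapInCharts (x₀ : X) :
    Function.Surjective (fderiv ℝ (orbitMapInCharts E F (K := K) x₀) (chartAt E (1 : K) 1)) := by
  have := ContMDiffMul.toIsManifold (I := 𝓘(ℝ, E)) (n := ∞) (G := K)
  have := ContMDiffSMul.continuousSMul (I := 𝓘(ℝ, E)) (I' := 𝓘(ℝ, F)) (G := K) (M := X) ∞
  have := topologicalGroup_of_lieGroup 𝓘(ℝ, E) ∞ (G := K)
  have h1 : (1 : K) ∈ (chartAt E (1 : K)).source := mem_chart_source E 1
  have hx₀ : x₀ ∈ (chartAt F x₀).source := mem_chart_source F x₀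
  have hp0 := (chartAt E (1 : K)).map_source h1
  have hcK1 := (chartAt E (1 : K)).left_inv h1
  have hd := contDiffAt_orbitMapInCharts (F := F) x₀ hp0 (by rwa [hcK1, one_smul])
  have hev : ∀ᶠ p in 𝓝 (chartAt E (1 : K) 1), p ∈ (chartAt E (1 : K)).target ∧
      (chartAt E (1 : K)).symm p • x₀ ∈ (chartAt F x₀).source := by
    refine ((chartAt E (1 : K)).open_target.eventually_mem hp0).and ?_
    refine (((chartAt E (1 : K)).continuousAt_symm hp0).smul continuousAt_const).eventually_mem
      ((chartAt F x₀).open_source.mem_nhds ?_)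
    change (chartAt E (1 : K)).symm _ • x₀ ∈ _
    rwa [hcK1, one_smul]
  obtain ⟨V, hV, hdim⟩ := exists_nhds_dimH_image_le (hd.of_le (by simp))
    (hev.mono fun p hp => finrank_range_fderiv_orbitMapInCharts_le x₀ hp.1 hp.2)
  have himage : orbitMapInCharts E F (K := K) x₀ '' V ∈ 𝓝 (chartAt F x₀ x₀) := by
    have e1 : (chartAt E (1 : K)).symm '' V ∈ 𝓝 (1 : K) := by
      have h := image_mem_map (m := (chartAt E (1 : K)).symm) hV
      rwa [(chartAt E (1 : K)).symm.map_nhds_eq hp0, hcK1] at h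
    -- A continuous transitive action of a σ-compact group on a compact Hausdorff space has open
    -- orbit maps, by Baire's theorem.
    have e2 : (fun g : K => g • x₀) '' ((chartAt E (1 : K)).symm '' V) ∈ 𝓝 x₀ := by
      have h := (isOpenMap_smul_of_sigmaCompact (G := K) x₀).image_mem_nhds e1
      rwa [one_smul] at h
    rw [← (chartAt F x₀).map_nhds_eq hx₀]
    have h := image_mem_map (m := chartAt F x₀) e2
    rwa [image_image, image_image] at h
  -- A set with interior has dimension `dim F`, so the rank cannot be smaller.
  have hge := Real.dimH_of_nonempty_interior ⟨_, mem_interior_iff_mem_nhds.2 himage⟩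
  rw [hge, Nat.cast_le] at hdim
  exact LinearMap.range_eq_top.1 (Submodule.eq_top_of_finrank_eq
    ((Submodule.finrank_le _).antisymm hdim))

/-- Local smooth sections of the orbit map. -/
theorem exists_contMDiffAt_section (x₀ : X) : ∃ τ : X → K,
    ContMDiffAt 𝓘(ℝ, F) 𝓘(ℝ, E) ∞ τ x₀ ∧ ∀ᶠ x in 𝓝 x₀, τ x • x₀ = x := by
  have := ContMDiffMul.toIsManifold (I := 𝓘(ℝ, E)) (n := ∞) (G := K)
  have := ContMDiffSMul.continuousSMul (I := 𝓘(ℝ, E)) (I' := 𝓘(ℝ, F)) (G := K) (M := X) ∞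
  have h1 : (1 : K) ∈ (chartAt E (1 : K)).source := mem_chart_source E 1
  have hx₀ : x₀ ∈ (chartAt F x₀).source := mem_chart_source F x₀
  set p₀ := chartAt E (1 : K) 1 with hp₀
  have hp0 : p₀ ∈ (chartAt E (1 : K)).target := (chartAt E (1 : K)).map_source h1
  have hcK1 : (chartAt E (1 : K)).symm p₀ = 1 := (chartAt E (1 : K)).left_inv h1
  have hd := contDiffAt_orbitMapInCharts (F := F) x₀ hp0 (by rwa [hcK1, one_smul])
  set f := orbitMapInCharts E F (K := K) x₀ with hf
  have hf0 : f p₀ = chartAt F x₀ x₀ := by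
    change chartAt F x₀ ((chartAt E (1 : K)).symm p₀ • x₀) = _
    rw [hcK1, one_smul]
  obtain ⟨R, hR⟩ := (fderiv ℝ f p₀).exists_rightInverse_of_surjective
    (LinearMap.range_eq_top.2 (surjective_fderiv_orbitMapInCharts (K := K) x₀))
  -- On the affine slice through `p₀` along a right inverse of the differential, `f` has identity
  -- derivative; its local inverse there yields the section.
  let ℓ : F → E := fun z => p₀ + R z
  have hℓ : ContDiff ℝ ∞ ℓ := contDiff_const.add R.contDiff
  have hℓ0 : ℓ 0 = p₀ := by simp [ℓ]
  have hs : ContDiffAt ℝ ∞ (f ∘ ℓ) 0 := ContDiffAt.comp 0 (by rwa [hℓ0]) hℓ.contDiffAt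
  have hs' : HasFDerivAt (f ∘ ℓ) (ContinuousLinearEquiv.refl ℝ F : F →L[ℝ] F) 0 := by
    have h2 : HasFDerivAt ℓ R 0 := R.hasFDerivAt.const_add p₀
    have h3 : HasFDerivAt f (fderiv ℝ f p₀) (ℓ 0) := by
      rw [hℓ0]
      exact (hd.differentiableAt (by simp)).hasFDerivAt
    have h4 := h3.comp 0 h2
    rw [hR] at h4
    exact h4
  obtain ⟨η, hη0, hη, hright, -⟩ := hs.exists_local_inverse hs' (by simp)
  have hs0 : (f ∘ ℓ) 0 = chartAt F x₀ x₀ := by simp [hℓ0, hf0]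
  rw [hs0] at hη0 hη hright
  have hcX : ContMDiffAt 𝓘(ℝ, F) 𝓘(ℝ, F) ∞ (chartAt F x₀) x₀ :=
    contMDiffAt_of_mem_maximalAtlas (IsManifold.chart_mem_maximalAtlas x₀) hx₀
  have hq : ContMDiffAt 𝓘(ℝ, F) 𝓘(ℝ, E) ∞ (fun x => ℓ (η (chartAt F x₀ x))) x₀ :=
    (hℓ.contDiffAt.comp _ hη).contMDiffAt.comp x₀ hcX
  have hq0 : ℓ (η (chartAt F x₀ x₀)) = p₀ := by rw [hη0, hℓ0]
  have hτ : ContMDiffAt 𝓘(ℝ, F) 𝓘(ℝ, E) ∞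
      (fun x => (chartAt E (1 : K)).symm (ℓ (η (chartAt F x₀ x)))) x₀ := by
    refine ContMDiffAt.comp x₀ (I' := 𝓘(ℝ, E)) ?_ hq
    rw [hq0]
    exact contMDiffAt_symm_of_mem_maximalAtlas (IsManifold.chart_mem_maximalAtlas 1) hp0
  refine ⟨_, hτ, ?_⟩
  have e1 : ∀ᶠ x in 𝓝 x₀,
      (chartAt E (1 : K)).symm (ℓ (η (chartAt F x₀ x))) • x₀ ∈ (chartAt F x₀).source := by
    refine (hτ.continuousAt.smul continuousAt_const).eventually_mem
      ((chartAt F x₀).open_source.mem_nhds ?_)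
    change (chartAt E (1 : K)).symm (ℓ (η (chartAt F x₀ x₀))) • x₀ ∈ _
    rwa [hq0, hcK1, one_smul]
  filter_upwards [e1, hcX.continuousAt.eventually hright,
    (chartAt F x₀).open_source.mem_nhds hx₀] with x hx1 hx2 hx3
  exact (chartAt F x₀).injOn hx1 hx3 hx2

end Orbit

/-! ### Smooth dependence of integrals on a parameter -/

theorem integrable_smul_of_continuousOn {E K G : Type*} [TopologicalSpace E] [TopologicalSpace K]
    [CompactSpace K] [MeasurableSpace K] [OpensMeasurableSpace K] [NormedAddCommGroup G]
    [NormedSpace ℝ G] (μ : Measure K) [IsFiniteMeasureOnCompacts μ] {a : K → ℝ} (ha : Continuous a)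
    {U : Set E} {F : E → K → G} (hF : ContinuousOn (Function.uncurry F) (U ×ˢ univ)) {q : E}
    (hq : q ∈ U) : Integrable (fun g => a g • F q g) μ := by
  have hc : Continuous fun g => a g • F q g :=
    ha.smul (hF.comp_continuous (Continuous.prodMk_right q) fun g => ⟨hq, mem_univ g⟩)
  exact hc.integrable_of_hasCompactSupport (HasCompactSupport.of_compactSpace _)

section ParametricIntegral

variable {E H : Type*} [NormedAddCommGroup E] [NormedSpace ℝ E]
  [NormedAddCommGroup H] [NormedSpace ℝ H]
  {K : Type*} [TopologicalSpace K] [ChartedSpace H K]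

theorem ContMDiffAt.differentiableAt_left {G : Type*} [NormedAddCommGroup G] [NormedSpace ℝ G]
    {F : E → K → G} {p : E} {g : K}
    (hF : ContMDiffAt (𝓘(ℝ, E).prod 𝓘(ℝ, H)) 𝓘(ℝ, G) ∞ (Function.uncurry F) (p, g)) :
    DifferentiableAt ℝ (fun q => F q g) p := by
  have h : ContMDiffAt 𝓘(ℝ, E) 𝓘(ℝ, G) ∞ (fun q => F q g) p :=
    ContMDiffAt.comp p hF (contMDiffAt_id.prodMk contMDiffAt_const)
  exact h.contDiffAt.differentiableAt (by simp)

variable [IsManifold 𝓘(ℝ, H) ∞ K]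

/-- The partial derivative of a smooth function on the product of a vector space and a manifold. -/
theorem ContMDiffAt.partial_fderiv {G : Type*} [NormedAddCommGroup G] [NormedSpace ℝ G]
    {F : E → K → G} {p : E} {g : K}
    (hF : ContMDiffAt (𝓘(ℝ, E).prod 𝓘(ℝ, H)) 𝓘(ℝ, G) ∞ (Function.uncurry F) (p, g)) :
    ContMDiffAt (𝓘(ℝ, E).prod 𝓘(ℝ, H)) 𝓘(ℝ, E →L[ℝ] G) ∞
      (Function.uncurry fun q k => fderiv ℝ (fun q => F q k) q) (p, g) := by
  have h := ContMDiffAt.mfderiv (I := 𝓘(ℝ, E)) (I' := 𝓘(ℝ, G)) (J := 𝓘(ℝ, E).prod 𝓘(ℝ, H))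
    (n := ∞) (m := ∞) (x₀ := (p, g)) (fun (r : E × K) (q : E) => F q r.2) Prod.fst ?_
    contMDiffAt_fst (by simp)
  · have e := inTangentCoordinates_model_space (I := 𝓘(ℝ, E)) (I' := 𝓘(ℝ, G))
      (Prod.fst : E × K → E) (fun r : E × K => F r.1 r.2)
      (fun r => fderiv ℝ (fun q => F q r.2) r.1) (p, g)
    simp only [mfderiv_eq_fderiv] at h
    exact h.congr_of_eventuallyEq (Eventually.of_forall (congrFun e.symm))
  · have h2 : ContMDiffAt ((𝓘(ℝ, E).prod 𝓘(ℝ, H)).prod 𝓘(ℝ, E)) (𝓘(ℝ, E).prod 𝓘(ℝ, H)) ∞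
        (fun r : (E × K) × E => (r.2, r.1.2)) ((p, g), p) :=
      contMDiffAt_snd.prodMk (contMDiffAt_snd.comp _ contMDiffAt_fst)
    exact ContMDiffAt.comp ((p, g), p) hF h2

variable [FiniteDimensional ℝ E] [CompactSpace K] [MeasurableSpace K] [BorelSpace K]

/-- The derivative is again an integral of `a` times a jointly smooth family, so the statement can
be iterated. The weight `a` need only be continuous. -/
theorem hasFDerivAt_integral_of_contMDiffAt {G : Type*} [NormedAddCommGroup G] [NormedSpace ℝ G]
    (μ : Measure K) [IsFiniteMeasureOnCompacts μ] {a : K → ℝ} (ha : Continuous a) {U : Set E}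
    (hU : IsOpen U) {F : E → K → G}
    (hF : ∀ p ∈ U, ∀ g, ContMDiffAt (𝓘(ℝ, E).prod 𝓘(ℝ, H)) 𝓘(ℝ, G) ∞ (Function.uncurry F) (p, g))
    {p : E} (hp : p ∈ U) :
    HasFDerivAt (fun q => ∫ g, a g • F q g ∂μ)
      (∫ g, a g • fderiv ℝ (fun q => F q g) p ∂μ) p := by
  have hcF : ContinuousOn (Function.uncurry F) (U ×ˢ univ) := fun r hr =>
    (hF r.1 hr.1 r.2).continuousAt.continuousWithinAt
  have hcF' : ContinuousOn (Function.uncurry fun q k => fderiv ℝ (fun q => F q k) q)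
      (U ×ˢ univ) := fun r hr =>
    (hF r.1 hr.1 r.2).partial_fderiv.continuousAt.continuousWithinAt
  obtain ⟨r, hr0, hrU⟩ := Metric.nhds_basis_closedBall.mem_iff.1 (hU.mem_nhds hp)
  -- Compactness of the ball times `K` gives a constant dominating function.
  obtain ⟨M, hM⟩ := ((isCompact_closedBall p r).prod (isCompact_univ (X := K))
    ).exists_bound_of_continuousOn (f := fun x : E × K => a x.2 • fderiv ℝ (fun q => F q x.2) x.1)
    ((ha.comp continuous_snd).continuousOn.smul (hcF'.mono (prod_mono_left hrU)))
  refine hasFDerivAt_integral_of_dominated_of_fderiv_le (bound := fun _ => M)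
    (F' := fun q g => a g • fderiv ℝ (fun q => F q g) q) (Metric.closedBall_mem_nhds p hr0)
    ?_ (integrable_smul_of_continuousOn μ ha hcF hp) (integrable_smul_of_continuousOn μ ha hcF' hp).aestronglyMeasurable ?_ ?_ ?_
  · filter_upwards [hU.mem_nhds hp] with q hq
    exact (integrable_smul_of_continuousOn μ ha hcF hq).aestronglyMeasurable
  · exact .of_forall fun g q hq => hM (q, g) ⟨hq, mem_univ g⟩
  · exact continuous_const.integrable_of_hasCompactSupport (HasCompactSupport.of_compactSpace _)
  · exact .of_forall fun g q hq =>
      (hF q (hrU hq) g).differentiableAt_left.hasFDerivAt.const_smul (a g)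

end ParametricIntegral

section ParametricIntegral

universe u v

variable {E : Type u} {H : Type*} [NormedAddCommGroup E] [NormedSpace ℝ E] [FiniteDimensional ℝ E]
  [NormedAddCommGroup H] [NormedSpace ℝ H]
  {K : Type*} [TopologicalSpace K] [ChartedSpace H K] [IsManifold 𝓘(ℝ, H) ∞ K]
  [CompactSpace K] [MeasurableSpace K] [BorelSpace K]

/-- Integrals over a compact manifold of functions that depend smoothly on a parameter. -/
theorem contDiffOn_integral_of_contMDiffAt (μ : Measure K) [IsFiniteMeasureOnCompacts μ]
    {a : K → ℝ} (ha : Continuous a) {U : Set E} (hU : IsOpen U) (k : ℕ)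
    {G : Type max u v} [NormedAddCommGroup G] [NormedSpace ℝ G] {F : E → K → G}
    (hF : ∀ p ∈ U, ∀ g,
      ContMDiffAt (𝓘(ℝ, E).prod 𝓘(ℝ, H)) 𝓘(ℝ, G) ∞ (Function.uncurry F) (p, g)) :
    ContDiffOn ℝ k (fun q => ∫ g, a g • F q g ∂μ) U := by
  -- Differentiation replaces `G` by `E →L[ℝ] G`; the universe `max u v` is stable under this.
  induction k generalizing G with
  | zero =>
    exact contDiffOn_zero.2 fun q hq =>
      (hasFDerivAt_integral_of_contMDiffAt μ ha hU hF hq).continuousAt.continuousWithinAt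
  | succ k ih =>
    refine (contDiffOn_succ_iff_hasFDerivWithinAt_of_uniqueDiffOn hU.uniqueDiffOn).2
      ⟨by simp, _, ih fun p hp g => (hF p hp g).partial_fderiv, fun q hq =>
        (hasFDerivAt_integral_of_contMDiffAt μ ha hU hF hq).hasFDerivWithinAt⟩

end ParametricIntegral

/-! ### Smoothness and convergence of convolutions -/

section Convolution

variable {d : ℕ} {K : Type*} [Group K] [TopologicalSpace K]
  [ChartedSpace (EuclideanSpace ℝ (Fin d)) K] [LieGroup (𝓡 d) ∞ K]
  [MeasurableSpace K] [BorelSpace K] (μ : Measure K)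

/-- Smooth nonnegative functions of integral one with small support. -/
theorem exists_smooth_cutoff [μ.IsHaarMeasure] [T2Space K] {U : Set K} (hU : U ∈ 𝓝 (1 : K)) :
    ∃ κ : K → ℝ, ContMDiff (𝓡 d) 𝓘(ℝ, ℝ) ∞ κ ∧ (∀ g, 0 ≤ κ g) ∧ ∫ g, κ g ∂μ = 1 ∧
      tsupport κ ⊆ U := by
  have := ContMDiffMul.toIsManifold (I := 𝓡 d) (n := ∞) (G := K)
  obtain ⟨f, -, hf⟩ := (SmoothBumpFunction.nhds_basis_tsupport (I := 𝓡 d) (1 : K)).mem_iff.1 hU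
  have hpos : 0 < ∫ g, f g ∂μ :=
    f.continuous.integral_pos_of_hasCompactSupport_nonneg_nonzero f.hasCompactSupport
      (fun _ => f.nonneg) (x := 1) (by simp)
  refine ⟨fun g => (∫ g, f g ∂μ)⁻¹ * f g, contMDiff_const.mul f.contMDiff,
    fun g => mul_nonneg (inv_nonneg.2 hpos.le) f.nonneg, ?_,
    (tsupport_mul_subset_right).trans hf⟩
  rw [integral_const_mul, inv_mul_cancel₀ hpos.ne']

variable [CompactSpace K]

/-- Convolutions of continuous functions with smooth functions on a Lie group are smooth. -/
theorem contMDiff_integral_smul_mul_left [IsFiniteMeasureOnCompacts μ] {a : K → ℝ}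
    (ha : Continuous a) {κ : K → ℝ} (hκ : ContMDiff (𝓡 d) 𝓘(ℝ, ℝ) ∞ κ) :
    ContMDiff (𝓡 d) 𝓘(ℝ, ℝ) ∞ fun h : K => ∫ g, a g • κ (h * g) ∂μ := by
  have := ContMDiffMul.toIsManifold (I := 𝓡 d) (n := ∞) (G := K)
  intro h₀
  set c := chartAt (EuclideanSpace ℝ (Fin d)) h₀ with hc
  have hh₀ : h₀ ∈ c.source := mem_chart_source _ h₀
  have hF : ∀ p ∈ c.target, ∀ g, ContMDiffAt ((𝓡 d).prod (𝓡 d)) 𝓘(ℝ, ℝ) ∞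
      (Function.uncurry fun p g => κ (c.symm p * g)) (p, g) := by
    intro p hp g
    have h1 : ContMDiffAt (𝓡 d) (𝓡 d) ∞ c.symm p :=
      contMDiffAt_symm_of_mem_maximalAtlas (IsManifold.chart_mem_maximalAtlas h₀) hp
    have h2 : ContMDiffAt ((𝓡 d).prod (𝓡 d)) (𝓡 d) ∞
        (fun q : EuclideanSpace ℝ (Fin d) × K => c.symm q.1 * q.2) (p, g) :=
      (ContMDiffAt.comp (p, g) (I' := 𝓡 d) h1 contMDiffAt_fst).mul contMDiffAt_snd
    exact hκ.contMDiffAt.comp (p, g) h2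
  have hJ : ContDiffOn ℝ ∞ (fun p => ∫ g, a g • κ (c.symm p * g) ∂μ) c.target :=
    contDiffOn_infty.2 fun k => contDiffOn_integral_of_contMDiffAt μ ha c.open_target k hF
  have h1 : ContMDiffAt (𝓡 d) (𝓡 d) ∞ c h₀ :=
    contMDiffAt_of_mem_maximalAtlas (IsManifold.chart_mem_maximalAtlas h₀) hh₀
  have h2 := (hJ.contDiffAt (c.open_target.mem_nhds (c.map_source hh₀))).comp_contMDiffAt h1
  refine h2.congr_of_eventuallyEq ?_
  filter_upwards [c.open_source.mem_nhds hh₀] with h hh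
  simp [c.left_inv hh]

variable [μ.IsHaarMeasure]

/-- Convolutions with smooth functions are smooth on homogeneous spaces. -/
theorem contMDiff_groupConvolution {F : Type*} [NormedAddCommGroup F] [NormedSpace ℝ F]
    [FiniteDimensional ℝ F] {X : Type*} [TopologicalSpace X] [T2Space X] [CompactSpace X]
    [ChartedSpace F X] [IsManifold 𝓘(ℝ, F) ∞ X] [MulAction K X]
    [ContMDiffSMul (𝓡 d) 𝓘(ℝ, F) ∞ K X] [MulAction.IsPretransitive K X]
    {κ : K → ℝ} (hκ : ContMDiff (𝓡 d) 𝓘(ℝ, ℝ) ∞ κ) {φ : X → ℝ} (hφ : Continuous φ) :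
    ContMDiff 𝓘(ℝ, F) 𝓘(ℝ, ℝ) ∞ (groupConvolution μ κ φ) := by
  have := ContMDiffSMul.continuousSMul (I := 𝓡 d) (I' := 𝓘(ℝ, F)) (G := K) (M := X) ∞
  have := topologicalGroup_of_lieGroup (𝓡 d) ∞ (G := K)
  intro x₀
  obtain ⟨τ, hτ, hτx⟩ := exists_contMDiffAt_section (E := EuclideanSpace ℝ (Fin d)) (F := F)
    (K := K) x₀
  have ha : Continuous fun g : K => φ (g⁻¹ • x₀) :=
    hφ.comp (continuous_inv.smul continuous_const)
  have h := (contMDiff_integral_smul_mul_left μ ha hκ).contMDiffAt.comp x₀ hτ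
  refine h.congr_of_eventuallyEq ?_
  filter_upwards [hτx] with x hx
  change ∫ g, φ (g⁻¹ • x) * κ g ∂μ = ∫ g, φ (g⁻¹ • x₀) • κ (τ x * g) ∂μ
  -- The substitution `g ↦ τ x * g` turns `g⁻¹ • x` into `g⁻¹ • x₀`, moving the dependence on `x`
  -- from `φ` to `κ`.
  rw [← integral_mul_left_eq_self (fun g => φ (g⁻¹ • x) * κ g) (τ x)]
  refine integral_congr_ae (.of_forall fun g => ?_)
  have hx' : (τ x * g)⁻¹ • x = g⁻¹ • x₀ := by
    nth_rw 2 [← hx]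
    rw [mul_inv_rev, mul_smul, inv_smul_smul]
  simp only [hx', smul_eq_mul]

end Convolution

/-- Convolutions with cut-off functions of small support are uniformly close to the function. -/
theorem exists_nhds_groupConvolution_sub_le {K X : Type*} [Group K] [TopologicalSpace K]
    [IsTopologicalGroup K] [CompactSpace K] [MeasurableSpace K] [BorelSpace K]
    [TopologicalSpace X] [CompactSpace X] [MulAction K X] [ContinuousSMul K X]
    (μ : Measure K) [IsFiniteMeasureOnCompacts μ] {φ : X → ℝ} (hφ : Continuous φ) {δ : ℝ}
    (hδ : 0 < δ) :
    ∃ U ∈ 𝓝 (1 : K), ∀ κ : K → ℝ, Continuous κ → (∀ g, 0 ≤ κ g) → ∫ g, κ g ∂μ = 1 →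
      tsupport κ ⊆ U → ∀ x, |groupConvolution μ κ φ x - φ x| ≤ δ := by
  have hc : Continuous (Function.uncurry fun (g : K) (x : X) => φ (g⁻¹ • x)) :=
    hφ.comp ((continuous_inv.comp continuous_fst).smul continuous_snd)
  -- Compactness of `X` makes continuity at `g = 1` uniform in `x`.
  obtain ⟨U, hU, hUφ⟩ := (isCompact_univ (X := X)).mem_uniformity_of_prod
    (s := univ) (q := (1 : K)) hc.continuousOn (mem_univ _) (Metric.dist_mem_uniformity hδ)
  rw [nhdsWithin_univ] at hU
  refine ⟨U, hU, fun κ hκ hκ0 hκ1 hκU x => ?_⟩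
  have hint : ∀ {f : K → ℝ}, Continuous f → Integrable f μ := fun hf =>
    hf.integrable_of_hasCompactSupport (HasCompactSupport.of_compactSpace _)
  have hcx : Continuous fun g : K => φ (g⁻¹ • x) :=
    hφ.comp (continuous_inv.smul continuous_const)
  have hsub : groupConvolution μ κ φ x - φ x = ∫ g, (φ (g⁻¹ • x) - φ x) * κ g ∂μ := by
    have hi : Integrable (fun g => φ (g⁻¹ • x) * κ g) μ := hint (hcx.mul hκ)
    simp_rw [sub_mul]
    rw [integral_sub hi ((hint hκ).const_mul _), integral_const_mul, hκ1, mul_one]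
    rfl
  rw [hsub, ← Real.norm_eq_abs]
  refine (norm_integral_le_of_norm_le ((hint hκ).const_mul δ) (.of_forall fun g => ?_)).trans_eq ?_
  · rw [norm_mul, Real.norm_of_nonneg (hκ0 g)]
    by_cases hg : g ∈ U
    · have h := hUφ g hg x (mem_univ x)
      simp only [mem_ofPred_eq, inv_one, one_smul, Real.dist_eq] at h
      exact mul_le_mul_of_nonneg_right h.le (hκ0 g)
    · have h0 : κ g = 0 := image_eq_zero_of_notMem_tsupport fun h => hg (hκU h)
      simp [h0]
  · rw [integral_const_mul, hκ1, mul_one]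

/-! ### Translates and convolutions under an action preserving `ω` -/

section Invariant

variable {n m : ℕ} {X : Type*} [TopologicalSpace X] [ChartedSpace (Fin n → ℂ) X]
  {K : Type*} [Group K] [MulAction K X]

/-- The biholomorphic map `x ↦ g • x`. -/
def smulDiffeomorph
    (hhol : ∀ g : K, ContMDiff 𝓘(ℂ, Fin n → ℂ) 𝓘(ℂ, Fin n → ℂ) ω (fun x : X => g • x)) (g : K) :
    X ≃ₘ^ω⟮𝓘(ℂ, Fin n → ℂ), 𝓘(ℂ, Fin n → ℂ)⟯ X where
  toEquiv := MulAction.toPerm g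
  contMDiff_toFun := hhol g
  contMDiff_invFun := hhol g⁻¹

variable [IsManifold 𝓘(ℂ, Fin n → ℂ) ω X]

theorem IsContSubharmonic.smul {ω₀ : RealForm n X}
    (hhol : ∀ g : K, ContMDiff 𝓘(ℂ, Fin n → ℂ) 𝓘(ℂ, Fin n → ℂ) ω (fun x : X => g • x))
    (hinv : IsInvariantForm K ω₀) {φ : X → ℝ} (hφ : IsContSubharmonic ω₀ m φ) (g : K) :
    IsContSubharmonic ω₀ m (fun x => φ (g • x)) :=
  hφ.comp_diffeomorph (smulDiffeomorph hhol g) (by ext x v w; exact hinv g x v w)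
    (by ext x v w; exact hinv g⁻¹ x v w)

theorem IsContSubharmonic.groupConvolution [TopologicalSpace K] [IsTopologicalGroup K]
    [CompactSpace K] [T2Space K] [MeasurableSpace K] [BorelSpace K] [ContinuousSMul K X]
    {ω₀ : RealForm n X}
    (hhol : ∀ g : K, ContMDiff 𝓘(ℂ, Fin n → ℂ) 𝓘(ℂ, Fin n → ℂ) ω (fun x : X => g • x))
    (hinv : IsInvariantForm K ω₀) {φ : X → ℝ} (hφ : IsContSubharmonic ω₀ m φ)
    (μ : Measure K) [IsFiniteMeasureOnCompacts μ] {κ : K → ℝ} (hκ : Continuous κ)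
    (hκ0 : ∀ g, 0 ≤ κ g) (hκ1 : ∫ g, κ g ∂μ = 1) :
    IsContSubharmonic ω₀ m (groupConvolution μ κ φ) :=
  IsContSubharmonic.average μ (U := fun g x => φ (g⁻¹ • x))
    (hφ.continuous.comp ((continuous_inv.comp continuous_fst).smul continuous_snd))
    (fun g => hφ.smul hhol hinv g⁻¹) hκ hκ0 hκ1

end Invariant

/-! ### Uniform limits and capacity -/

section Capacity

variable {n : ℕ} {X : Type*} [TopologicalSpace X] [ChartedSpace (Fin n → ℂ) X]

theorem hessianMass_empty (ω₀ : RealForm n X) (m : ℕ) (φ : X → ℝ) :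
    hessianMass ω₀ m φ ∅ = 0 := by
  simp only [hessianMass, ENNReal.iSup_eq_zero]
  intro N ψ A hA _
  refine Finset.sum_eq_zero fun i _ => ?_
  have h : A i = ∅ := subset_empty_iff.1 ((hA i).2.2.trans (by simp))
  simp [h]

theorem outerCap_empty (ω₀ : RealForm n X) (m : ℕ) : outerCap ω₀ m ∅ = 0 := by
  refine le_antisymm (iInf₂_le_of_le ∅ isOpen_empty (iInf_le_of_le Subset.rfl ?_)) zero_le
  simp [innerCap, hessianMass_empty]

/-- The empty set serves for every `δ`, so the only property of the capacity that is needed is its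
vanishing on `∅`. -/
theorem TendstoUniformly.quasiUniformlyTendsto {ω₀ : RealForm n X} {m : ℕ} {φs : ℕ → X → ℝ}
    {φ : X → ℝ} (h : TendstoUniformly φs φ atTop) : QuasiUniformlyTendsto ω₀ m φs φ :=
  fun _ _ => ⟨∅, isOpen_empty, by simp [outerCap_empty], h.tendstoUniformlyOn⟩

end Capacity

theorem mainTheorem8 {n m d : ℕ} (hm : 1 ≤ m) (hmn : m ≤ n)
    {X : Type*} [TopologicalSpace X] [T2Space X] [CompactSpace X]
    [ChartedSpace (Fin n → ℂ) X] [IsManifold 𝓘(ℂ, Fin n → ℂ) ω X]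
    (ω₀ : RealForm n X) (hω₀ : IsKahler ω₀)
    {K : Type*} [Group K] [TopologicalSpace K] [T2Space K] [CompactSpace K]
    [ChartedSpace (EuclideanSpace ℝ (Fin d)) K] [LieGroup (𝓡 d) ∞ K]
    [MeasurableSpace K] [BorelSpace K] (μ : Measure K) [μ.IsHaarMeasure]
    [MulAction K X] [ContMDiffSMul (𝓡 d) 𝓘(ℝ, Fin n → ℂ) ∞ K X]
    (hhol : ∀ g : K, ContMDiff 𝓘(ℂ, Fin n → ℂ) 𝓘(ℂ, Fin n → ℂ) ω (fun x : X => g • x))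
    (htrans : MulAction.IsPretransitive K X)
    (hinv : IsInvariantForm K ω₀)
    (φ : X → ℝ) (hφ : IsContSubharmonic ω₀ m φ) :
    (∀ χ : ℝ → K → ℝ, IsCutoffFamily (d := d) μ χ →
      (∀ ε : ℝ, 0 < ε →
        ContMDiff 𝓘(ℝ, Fin n → ℂ) 𝓘(ℝ, ℝ) ∞ (groupConvolution μ (χ ε) φ) ∧
        IsContSubharmonic ω₀ m (groupConvolution μ (χ ε) φ)) ∧
      TendstoUniformly (fun ε : ℝ => groupConvolution μ (χ ε) φ) φ (𝓝[>] 0)) ∧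
    φ ∈ classP ω₀ m := by
  have := IsManifold.restrictScalars_real (Fin n → ℂ) X
  have := ContMDiffSMul.continuousSMul (I := 𝓡 d) (I' := 𝓘(ℝ, Fin n → ℂ)) (G := K) (M := X) ∞
  have := topologicalGroup_of_lieGroup (𝓡 d) ∞ (G := K)
  refine ⟨fun χ hχ => ⟨fun ε hε => ⟨?_, ?_⟩, ?_⟩, hφ, ?_⟩
  · exact contMDiff_groupConvolution μ (hχ.smooth ε hε) hφ.continuous
  · exact hφ.groupConvolution hhol hinv μ (hχ.smooth ε hε).continuous (hχ.nonneg ε hε)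
      (hχ.integral_eq_one ε hε)
  · rw [Metric.tendstoUniformly_iff]
    intro δ hδ
    obtain ⟨U, hU, hUφ⟩ := exists_nhds_groupConvolution_sub_le μ hφ.continuous (half_pos hδ)
    filter_upwards [hχ.support_shrinks U hU, self_mem_nhdsWithin] with ε hε hε0 x
    rw [dist_comm, Real.dist_eq]
    exact (hUφ _ (hχ.smooth ε hε0).continuous (hχ.nonneg ε hε0) (hχ.integral_eq_one ε hε0) hε
      x).trans_lt (half_lt_self hδ)
  -- Membership in the class needs a sequence and no given cut-off family: normalized bump functions
  -- with error at most `1 / (j + 1)` provide it.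
  · have h : ∀ j : ℕ, ∃ κ : K → ℝ, ContMDiff (𝓡 d) 𝓘(ℝ, ℝ) ∞ κ ∧ (∀ g, 0 ≤ κ g) ∧
        ∫ g, κ g ∂μ = 1 ∧ ∀ x, |groupConvolution μ κ φ x - φ x| ≤ 1 / ((j : ℝ) + 1) := by
      intro j
      obtain ⟨U, hU, hUφ⟩ := exists_nhds_groupConvolution_sub_le μ hφ.continuous
        (Nat.one_div_pos_of_nat (α := ℝ) (n := j))
      obtain ⟨κ, h1, h2, h3, h4⟩ := exists_smooth_cutoff (d := d) μ hU
      exact ⟨κ, h1, h2, h3, hUφ κ h1.continuous h2 h3 h4⟩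
    choose κ hκ hκ0 hκ1 hκφ using h
    refine ⟨fun j => groupConvolution μ (κ j) φ, fun j => ⟨?_, ?_⟩,
      TendstoUniformly.quasiUniformlyTendsto ?_⟩
    · exact (contMDiff_groupConvolution μ (hκ j) hφ.continuous).of_le ENat.LEInfty.out
    · exact hφ.groupConvolution hhol hinv μ (hκ j).continuous (hκ0 j) (hκ1 j)
    · rw [Metric.tendstoUniformly_iff]
      intro δ hδ
      filter_upwards [tendsto_one_div_add_atTop_nhds_zero_nat.eventually_lt_const hδ] with j hj x
      rw [dist_comm, Real.dist_eq]
      exact (hκφ j x).trans_lt hj
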